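/- Let $\langle y\rangle = 1+|y|$. For real numbers $\alpha$ and $\beta \neq 0$ put $p(\xi) = -\beta\xi^5 + \alpha\xi^3$, and for $s, b \in \mathbb{R}$ let $X_{s,b}$ be the completion of $C_0^\infty(\mathbb{R}^2)$ (complex-valued functions of $(x,t)$) with respect to the norm $$\|f\|_{X_{s,b}} = \Big( \int_{\mathbb{R}^2} \langle \xi\rangle^{2s} \langle \tau - p(\xi)\rangle^{2b}\, |\widehat f(\xi,\tau)|^2 \, d\xi\, d\tau \Big)^{1/2}, \qquad \widehat f(\xi,\tau) = \int_{\mathbb{R}^2} e^{-i(x\xi + t\tau)} f(x,t)\, dx\, dt .$$ **Proposition 2.2.** For every $s > -\frac74$ there is $b$ with $\frac12 < b < 1$, depending only on $s$, such that for all real $\alpha$ and all real $\beta \ne 0$ there is a constant $c > 0$ (depending only on $s$, $b$ and the coefficients $\alpha, \beta$) for which the bilinear map $(u,v) \mapsto \partial_x(uv)$, defined on $C_0^\infty(\mathbb{R}^2)$, extends to a bounded bilinear map $X_{s,b} \times X_{s,b} \to X_{s,b-1}$ with $$\|\partial_x(uv)\|_{X_{s,b-1}} \le c\, \|u\|_{X_{s,b}}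 \|v\|_{X_{s,b}} \qquad \text{for all } u, v \in X_{s,b}.$$ -/

import Mathlib

open MeasureTheory TopologicalSpace
open scoped Distributions ContDiff LineDeriv

namespace Kawahara

/-- The space of complex-valued functions of class `C_0^∞` on the plane, with coordinates
`(x, t)`. -/
abbrev Test : Type := 𝓓((⊤ : Opens (ℝ × ℝ)), ℂ)

/-- The pointwise product of two test functions. -/
noncomputable def Test.mul (u v : Test) : Test where
  toFun := fun z => u z * v z
  contDiff' := u.contDiff.mul v.contDiff
  hasCompactSupport' := u.hasCompactSupport.mul_right
  tsupport_subset' := fun _ _ => trivial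

/-- The derivative `∂_x u` in the first variable. -/
noncomputable def Test.dx (u : Test) : Test := ∂_{((1, 0) : ℝ × ℝ)} u

/-- The space-time Fourier transform `û(ξ, τ) = ∫ e^{-i(xξ + tτ)} u(x, t) dx dt`. -/
noncomputable def fourier (u : ℝ × ℝ → ℂ) (ζ : ℝ × ℝ) : ℂ :=
  ∫ z : ℝ × ℝ, Complex.exp (-Complex.I * ((z.1 * ζ.1 + z.2 * ζ.2 : ℝ) : ℂ)) * u z

/-- The phase `p(ξ) = -β ξ^5 + α ξ^3`. -/
def phase (α β ξ : ℝ) : ℝ := -β * ξ ^ 5 + α * ξ ^ 3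

/-- The weight `⟨ξ⟩^{2s} ⟨τ - p(ξ)⟩^{2b}`, with `⟨y⟩ = 1 + |y|`. -/
noncomputable def weight (α β s b : ℝ) (ζ : ℝ × ℝ) : ℝ :=
  (1 + |ζ.1|) ^ (2 * s) * (1 + |ζ.2 - phase α β ζ.1|) ^ (2 * b)

/-- The norm `‖u‖_{X_{s,b}} = (∫ ⟨ξ⟩^{2s} ⟨τ - p(ξ)⟩^{2b} |û(ξ, τ)|² dξ dτ)^{1/2}`. -/
noncomputable def bourgainNorm (α β s b : ℝ) (u : ℝ × ℝ → ℂ) : ℝ :=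
  √ (∫ ζ : ℝ × ℝ, weight α β s b ζ * ‖fourier u ζ‖ ^ 2)

/-! The next facts show that `bourgainNorm` is finite and a seminorm on test functions. -/

/-- The pairing `(x, t), (ξ, τ) ↦ (xξ + tτ) / 2π`. -/
noncomputable def pairing : (ℝ × ℝ) →L[ℝ] (ℝ × ℝ) →L[ℝ] ℝ :=
  (2 * Real.pi)⁻¹ •
    ((ContinuousLinearMap.mul ℝ ℝ).bilinearComp (.fst ℝ ℝ ℝ) (.fst ℝ ℝ ℝ) +
     (ContinuousLinearMap.mul ℝ ℝ).bilinearComp (.snd ℝ ℝ ℝ) (.snd ℝ ℝ ℝ))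

theorem pairing_apply (z ζ : ℝ × ℝ) :
    pairing z ζ = (2 * Real.pi)⁻¹ * (z.1 * ζ.1 + z.2 * ζ.2) := by
  simp [pairing]
  ring

theorem fourier_eq (u : ℝ × ℝ → ℂ) :
    fourier u = VectorFourier.fourierIntegral Real.fourierChar volume pairing.toLinearMap₁₂ u := by
  funext ζ
  unfold fourier VectorFourier.fourierIntegral
  refine integral_congr_ae (Filter.Eventually.of_forall fun z => ?_)
  simp only [Circle.smul_def, Real.fourierChar_apply, smul_eq_mul]
  congr 2
  have h : pairing.toLinearMap₁₂ z ζ = (2 * Real.pi)⁻¹ * (z.1 * ζ.1 + z.2 * ζ.2) :=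
    pairing_apply z ζ
  simp only [h]
  have hpi : (Real.pi : ℂ) ≠ 0 := by exact_mod_cast Real.pi_ne_zero
  push_cast
  field_simp

theorem Test.integrable (u : Test) : Integrable (u : ℝ × ℝ → ℂ) :=
  u.continuous.integrable_of_hasCompactSupport u.hasCompactSupport

theorem fourier_continuous (u : Test) : Continuous (fourier u) := by
  rw [fourier_eq]
  exact VectorFourier.fourierIntegral_continuous Real.continuous_fourierChar
    pairing.continuous₂ u.integrable

theorem fourier_add (u v : Test) (ζ : ℝ × ℝ) :
    fourier (u + v : Test) ζ = fourier u ζ + fourier v ζ := by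
  simp only [fourier_eq]
  have := VectorFourier.fourierIntegral_add (L := pairing.toLinearMap₁₂)
    Real.continuous_fourierChar pairing.continuous₂ u.integrable v.integrable
  rw [FunLike.coe_add, this, Pi.add_apply]

theorem fourier_smul (c : ℂ) (u : Test) (ζ : ℝ × ℝ) :
    fourier (c • u : Test) ζ = c * fourier u ζ := by
  unfold fourier
  rw [← integral_const_mul]
  refine integral_congr_ae (Filter.Eventually.of_forall fun z => ?_)
  have : (c • u : Test) z = c * u z := rfl
  simp only [this]
  ring

theorem fourier_decay_aux (u : Test) (n : ℕ) (z : ℝ × ℝ) :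
    ∃ C : ℝ, ∀ ζ, |z.1 * ζ.1 + z.2 * ζ.2| ^ n * ‖fourier u ζ‖ ≤ C := by
  have hint : ∀ (k m : ℕ), (k : ℕ∞) ≤ ⊤ → (m : ℕ∞) ≤ ⊤ →
      Integrable (fun v ↦ ‖v‖ ^ k * ‖iteratedFDeriv ℝ m u v‖) := by
    intro k m _ _
    have h1 : Continuous (iteratedFDeriv ℝ m u) :=
      u.contDiff.continuous_iteratedFDeriv (by exact_mod_cast le_top)
    refine Continuous.integrable_of_hasCompactSupport (by fun_prop) ?_
    exact ((u.hasCompactSupport.iteratedFDeriv m).norm).mul_left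
  have h := fun ζ => VectorFourier.pow_mul_norm_iteratedFDeriv_fourierIntegral_le pairing
    (μ := volume) u.contDiff hint (k := 0) (n := n) le_top le_top z ζ
  simp only [norm_iteratedFDeriv_zero, ← fourier_eq, pairing_apply] at h
  have h2 := fun ζ => mul_le_mul_of_nonneg_left (h ζ)
    (show (0 : ℝ) ≤ (2 * Real.pi) ^ n by positivity)
  refine ⟨_, fun ζ => le_trans (le_of_eq ?_) (h2 ζ)⟩
  have hpi : (0 : ℝ) < 2 * Real.pi := by positivity
  rw [abs_mul, abs_of_pos (inv_pos.2 hpi), ← mul_assoc, ← mul_pow, ← mul_assoc,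
    mul_inv_cancel₀ hpi.ne', one_mul]

theorem one_add_pow_le (y : ℝ) (hy : 0 ≤ y) (n : ℕ) : (1 + y) ^ n ≤ 2 ^ n * (1 + y ^ n) := by
  rcases le_total y 1 with h | h
  · calc (1 + y) ^ n ≤ 2 ^ n := pow_le_pow_left₀ (by linarith) (by linarith) n
      _ ≤ 2 ^ n * (1 + y ^ n) := le_mul_of_one_le_right (by positivity)
          (by linarith [pow_nonneg hy n])
  · calc (1 + y) ^ n ≤ (2 * y) ^ n := pow_le_pow_left₀ (by linarith) (by linarith) n
      _ = 2 ^ n * y ^ n := mul_pow _ _ _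
      _ ≤ 2 ^ n * (1 + y ^ n) := by gcongr; linarith

theorem fourier_decay (u : Test) (m : ℕ) :
    ∃ C : ℝ, ∀ ζ : ℝ × ℝ, ((1 + |ζ.1|) * (1 + |ζ.2|)) ^ m * ‖fourier u ζ‖ ≤ C := by
  obtain ⟨C₀, h₀⟩ := fourier_decay_aux u 0 0
  obtain ⟨C₁, h₁⟩ := fourier_decay_aux u (2 * m) (1, 0)
  obtain ⟨C₂, h₂⟩ := fourier_decay_aux u (2 * m) (0, 1)
  refine ⟨2 ^ (2 * m) * (C₀ + C₁) + 2 ^ (2 * m) * (C₀ + C₂), fun ζ => ?_⟩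
  have e₀ := h₀ ζ
  have e₁ := h₁ ζ
  have e₂ := h₂ ζ
  simp only [pow_zero, one_mul, zero_mul, add_zero, zero_add] at e₀ e₁ e₂
  have a₁ := one_add_pow_le |ζ.1| (abs_nonneg _) (2 * m)
  have a₂ := one_add_pow_le |ζ.2| (abs_nonneg _) (2 * m)
  have hF := norm_nonneg (fourier u ζ)
  have hprod : ((1 + |ζ.1|) * (1 + |ζ.2|)) ^ m ≤
      (1 + |ζ.1|) ^ (2 * m) + (1 + |ζ.2|) ^ (2 * m) := by
    rw [mul_pow, pow_mul', pow_mul']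
    nlinarith [sq_nonneg ((1 + |ζ.1|) ^ m - (1 + |ζ.2|) ^ m),
      sq_nonneg ((1 + |ζ.1|) ^ m), sq_nonneg ((1 + |ζ.2|) ^ m)]
  calc ((1 + |ζ.1|) * (1 + |ζ.2|)) ^ m * ‖fourier u ζ‖
      ≤ (2 ^ (2 * m) * (1 + |ζ.1| ^ (2 * m)) + 2 ^ (2 * m) * (1 + |ζ.2| ^ (2 * m))) *
        ‖fourier u ζ‖ := mul_le_mul_of_nonneg_right (hprod.trans (add_le_add a₁ a₂)) hF
    _ = 2 ^ (2 * m) * (‖fourier u ζ‖ + |ζ.1| ^ (2 * m) * ‖fourier u ζ‖) +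
        2 ^ (2 * m) * (‖fourier u ζ‖ + |ζ.2| ^ (2 * m) * ‖fourier u ζ‖) := by ring
    _ ≤ _ := by gcongr

theorem rpow_le_natPow (y r : ℝ) (hy : 1 ≤ y) : y ^ r ≤ y ^ ⌈|r|⌉₊ := by
  rw [← Real.rpow_natCast]
  exact Real.rpow_le_rpow_of_exponent_le hy ((le_abs_self r).trans (Nat.le_ceil _))

theorem weight_nonneg (α β s b : ℝ) (ζ : ℝ × ℝ) : 0 ≤ weight α β s b ζ := by
  unfold weight; positivity

theorem weight_continuous (α β s b : ℝ) : Continuous (weight α β s b) := by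
  unfold weight phase
  refine Continuous.mul (Continuous.rpow_const (by fun_prop) fun ζ => Or.inl ?_)
    (Continuous.rpow_const (by fun_prop) fun ζ => Or.inl ?_) <;> positivity

theorem weight_le (α β s b : ℝ) : ∃ (C : ℝ) (m : ℕ), ∀ ζ : ℝ × ℝ,
    weight α β s b ζ ≤ C * ((1 + |ζ.1|) * (1 + |ζ.2|)) ^ m := by
  set M := ⌈|2 * s|⌉₊
  set N := ⌈|2 * b|⌉₊
  set K := 1 + |α| + |β|
  have hK : 1 ≤ K := by
    have := abs_nonneg α
    have := abs_nonneg β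
    simp only [K]; linarith
  refine ⟨K ^ N, M + 5 * N, fun ζ => ?_⟩
  set X := 1 + |ζ.1| with hX
  set T := 1 + |ζ.2| with hT
  have hX1 : 1 ≤ X := by simp [hX]
  have hT1 : 1 ≤ T := by simp [hT]
  have hp : |phase α β ζ.1| ≤ (|α| + |β|) * X ^ 5 := by
    unfold phase
    have h5 : |ζ.1| ^ 5 ≤ X ^ 5 := pow_le_pow_left₀ (abs_nonneg _) (by simp [hX]) 5
    have h3 : |ζ.1| ^ 3 ≤ X ^ 5 :=
      (pow_le_pow_left₀ (abs_nonneg _) (by simp [hX]) 3).trans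
        (pow_le_pow_right₀ hX1 (by norm_num))
    calc |-β * ζ.1 ^ 5 + α * ζ.1 ^ 3| ≤ |-β * ζ.1 ^ 5| + |α * ζ.1 ^ 3| := abs_add_le _ _
      _ = |β| * |ζ.1| ^ 5 + |α| * |ζ.1| ^ 3 := by simp [abs_mul, abs_pow]
      _ ≤ |β| * X ^ 5 + |α| * X ^ 5 := by gcongr
      _ = _ := by ring
  have hmod : 1 + |ζ.2 - phase α β ζ.1| ≤ K * (X ^ 5 * T) := by
    have h1 : |ζ.2 - phase α β ζ.1| ≤ |ζ.2| + |phase α β ζ.1| := abs_sub _ _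
    have hX5 : 1 ≤ X ^ 5 := one_le_pow₀ hX1
    have hab : 0 ≤ |α| + |β| := by positivity
    calc 1 + |ζ.2 - phase α β ζ.1| ≤ T + (|α| + |β|) * X ^ 5 := by
          simp only [hT]; linarith
      _ ≤ X ^ 5 * T + (|α| + |β|) * (X ^ 5 * T) := by
          gcongr
          · exact le_mul_of_one_le_left (by linarith) hX5
          · exact le_mul_of_one_le_right (by linarith) hT1
      _ = K * (X ^ 5 * T) := by simp only [K]; ring
  calc weight α β s b ζ ≤ X ^ M * (1 + |ζ.2 - phase α β ζ.1|) ^ N := by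
        unfold weight
        gcongr
        · exact rpow_le_natPow _ _ hX1
        · exact rpow_le_natPow _ _ (by simp)
    _ ≤ X ^ M * (K * (X ^ 5 * T)) ^ N := by gcongr
    _ = K ^ N * (X ^ (M + 5 * N) * T ^ N) := by ring_nf
    _ ≤ K ^ N * (X ^ (M + 5 * N) * T ^ (M + 5 * N)) := by
        gcongr
        exact (show N ≤ M + 5 * N by omega)
    _ = _ := by rw [mul_pow]

/-- The integrand of the norm is integrable, so that the norm of a test function is finite. -/
theorem integrable_weight_mul (α β s b : ℝ) (u : Test) :
    Integrable (fun ζ : ℝ × ℝ => weight α β s b ζ * ‖fourier u ζ‖ ^ 2) := by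
  obtain ⟨C, m, hC⟩ := weight_le α β s b
  obtain ⟨D, hD⟩ := fourier_decay u (m + 1)
  have hbase : Integrable (fun ζ : ℝ × ℝ => (1 + ζ.1 ^ 2)⁻¹ * (1 + ζ.2 ^ 2)⁻¹) :=
    integrable_inv_one_add_sq.mul_prod integrable_inv_one_add_sq
  refine (hbase.const_mul (|C| * D ^ 2)).mono'
    ((weight_continuous α β s b).mul
      ((fourier_continuous u).norm.pow 2)).aestronglyMeasurable
    (Filter.Eventually.of_forall fun ζ => ?_)
  have hw := weight_nonneg α β s b ζ
  rw [Real.norm_of_nonneg (by positivity)]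
  set P := (1 + |ζ.1|) * (1 + |ζ.2|) with hP
  have hP1 : 1 ≤ P := by
    have := abs_nonneg ζ.1
    have := abs_nonneg ζ.2
    rw [hP]; nlinarith
  have hsq : (1 + ζ.1 ^ 2) * (1 + ζ.2 ^ 2) ≤ P ^ 2 := by
    rw [hP, mul_pow]
    gcongr
    · nlinarith [abs_nonneg ζ.1, sq_abs ζ.1]
    · nlinarith [abs_nonneg ζ.2, sq_abs ζ.2]
  have h1 : (P ^ (m + 1) * ‖fourier u ζ‖) ^ 2 ≤ D ^ 2 :=
    pow_le_pow_left₀ (by positivity) (hD ζ) 2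
  rw [← mul_inv, ← div_eq_mul_inv, le_div_iff₀ (by positivity)]
  have hCabs : weight α β s b ζ ≤ |C| * P ^ m :=
    (hC ζ).trans (by gcongr; exact le_abs_self C)
  calc weight α β s b ζ * ‖fourier u ζ‖ ^ 2 * ((1 + ζ.1 ^ 2) * (1 + ζ.2 ^ 2))
      ≤ |C| * P ^ (2 * m) * ‖fourier u ζ‖ ^ 2 * P ^ 2 := by
        gcongr
        exact hCabs.trans (by gcongr; exact (show m ≤ 2 * m by omega))
    _ = |C| * (P ^ (m + 1) * ‖fourier u ζ‖) ^ 2 := by ring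
    _ ≤ |C| * D ^ 2 := by gcongr

theorem memLp_weighted (α β s b : ℝ) (u : Test) :
    MemLp (fun ζ : ℝ × ℝ => ((√(weight α β s b ζ) : ℝ) : ℂ) * fourier u ζ) 2 := by
  have hc : Continuous (fun ζ : ℝ × ℝ => ((√(weight α β s b ζ) : ℝ) : ℂ) * fourier u ζ) :=
    (Complex.continuous_ofReal.comp (weight_continuous α β s b).sqrt).mul (fourier_continuous u)
  rw [memLp_two_iff_integrable_sq_norm hc.aestronglyMeasurable]
  refine (integrable_weight_mul α β s b u).congr (Filter.Eventually.of_forall fun ζ => ?_)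
  simp [mul_pow, Real.sq_sqrt (weight_nonneg α β s b ζ)]

theorem bourgainNorm_eq (α β s b : ℝ) (u : Test) :
    bourgainNorm α β s b u =
      (eLpNorm (fun ζ : ℝ × ℝ => ((√(weight α β s b ζ) : ℝ) : ℂ) * fourier u ζ) 2).toReal := by
  rw [(memLp_weighted α β s b u).eLpNorm_eq_integral_rpow_norm (by norm_num) (by norm_num),
    ENNReal.toReal_ofReal (by positivity), bourgainNorm, Real.sqrt_eq_rpow]
  norm_num
  congr 1
  refine integral_congr_ae (Filter.Eventually.of_forall fun ζ => ?_)
  simp [mul_pow, Real.sq_sqrt (weight_nonneg α β s b ζ)]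

theorem bourgainNorm_smul (α β s b : ℝ) (c : ℂ) (u : Test) :
    bourgainNorm α β s b (c • u : Test) = ‖c‖ * bourgainNorm α β s b u := by
  unfold bourgainNorm
  have : ∀ ζ, weight α β s b ζ * ‖fourier (c • u : Test) ζ‖ ^ 2 =
      ‖c‖ ^ 2 * (weight α β s b ζ * ‖fourier u ζ‖ ^ 2) := by
    intro ζ
    rw [fourier_smul, norm_mul]; ring
  simp_rw [this]
  rw [integral_const_mul, Real.sqrt_mul (by positivity), Real.sqrt_sq (norm_nonneg c)]

theorem bourgainNorm_add (α β s b : ℝ) (u v : Test) :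
    bourgainNorm α β s b (u + v : Test) ≤ bourgainNorm α β s b u + bourgainNorm α β s b v := by
  simp only [bourgainNorm_eq, fourier_add, mul_add]
  have hu := memLp_weighted α β s b u
  have hv := memLp_weighted α β s b v
  rw [← ENNReal.toReal_add hu.eLpNorm_ne_top hv.eLpNorm_ne_top]
  exact ENNReal.toReal_mono (ENNReal.add_ne_top.2 ⟨hu.eLpNorm_ne_top, hv.eLpNorm_ne_top⟩)
    (eLpNorm_add_le hu.1 hv.1 (by norm_num))

/-- Test functions, to be normed by `‖·‖_{X_{s,b}}`. -/
def NormedTest (_α _β _s _b : ℝ) : Type := Test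

namespace NormedTest

variable (α β s b : ℝ)

noncomputable instance : AddCommGroup (NormedTest α β s b) :=
  inferInstanceAs (AddCommGroup Test)

noncomputable instance : Module ℂ (NormedTest α β s b) :=
  inferInstanceAs (Module ℂ Test)

noncomputable instance : Norm (NormedTest α β s b) where
  norm u := bourgainNorm α β s b (show Test from u)

theorem core : SeminormedSpace.Core ℂ (NormedTest α β s b) where
  norm_nonneg _ := Real.sqrt_nonneg _
  norm_smul c u := bourgainNorm_smul α β s b c u
  norm_triangle u v := bourgainNorm_add α β s b u v

noncomputable instance : SeminormedAddCommGroup (NormedTest α β s b) :=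
  SeminormedAddCommGroup.ofCore (core α β s b)

noncomputable instance : NormedSpace ℂ (NormedTest α β s b) where
  norm_smul_le c u := ((core α β s b).norm_smul c u).le

end NormedTest

/-- The Bourgain space `X_{s,b}`: the completion of `C_0^∞` in the norm `‖·‖_{X_{s,b}}`. -/
abbrev BourgainSpace (α β s b : ℝ) : Type := UniformSpace.Completion (NormedTest α β s b)

/-- A test function as an element of `X_{s,b}`. -/
noncomputable def Test.toBourgain (α β s b : ℝ) (u : Test) : BourgainSpace α β s b :=
  ((show NormedTest α β s b from u : NormedTest α β s b) : BourgainSpace α β s b)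

theorem norm_toBourgain (α β s b : ℝ) (u : Test) :
    ‖u.toBourgain α β s b‖ = bourgainNorm α β s b u :=
  UniformSpace.Completion.norm_coe (E := NormedTest α β s b) u

theorem denseRange_toBourgain (α β s b : ℝ) : DenseRange (Test.toBourgain α β s b) :=
  UniformSpace.Completion.denseRange_coe (α := NormedTest α β s b)

theorem dx_apply (u : Test) (x t : ℝ) :
    u.dx (x, t) = deriv (fun y : ℝ => u (y, t)) x := by
  have h : u.dx (x, t) = lineDeriv ℝ u (x, t) (1, 0) :=
    TestFunction.lineDerivCLM_apply_of_le (𝕜 := ℝ) (n := ⊤) (k := ⊤) (f := u) (by simp)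
  rw [h, lineDeriv]
  have := deriv_comp_const_add (f := fun y : ℝ => u (y, t)) x 0
  simpa using this

end Kawahara

/-! Let x, y be the input frequencies, ξ = x + y the output frequency, σ₁, σ₂, σ₀ the corresponding
modulations τ - p, and put θ = 2(1 - b), so that 2b = 2 - θ. On the Fourier side the estimate is an
L² bound for a bilinear form whose squared kernel is ξ²⟨ξ⟩^{2s}⟨x⟩^{-2s}⟨y⟩^{-2s} times
⟨σ₀⟩^{-θ}⟨σ₁⟩^{-(2-θ)}⟨σ₂⟩^{-(2-θ)}.

The combination σ₀ - σ₁ - σ₂ equals p(x) + p(y) - p(ξ) = ξxy(5β(x² + xy + y²) - 3α), which at high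
frequency is at least a multiple of |ξxy|(x² + y²). The largest modulation is at least a third of
this, so `modulation_le` gains ⟨resonance⟩^{-θ} and still leaves the exponent 2 - θ > 1 on both
remaining modulations.

Cauchy–Schwarz (`lintegral_sq_bilinear_le`) is applied with the variable carrying the largest
modulation held fixed. Integrating the time frequency merges the other two modulations into ⟨a -
p(x) - p(η - x)⟩^{-(2-θ)}, and the substitution μ = p(x) + p(η - x) absorbs a weight as large as its
Jacobian, of size |η||2x - η|(x² + (η - x)²). The Jacobian degenerates at x = η/2; there an interval
of length 1/⟨η⟩ affords the weight ⟨η⟩. These, with a bounded set, make up `multiplier`, and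
`exists_lintegral_kernel_le` is the uniform bound.

What remains is pointwise (`exists_freqWeight_mul_modulation_le`): the frequency weight times the
resonance gain is at most a constant times the multiplier, whichever variable is fixed. With ρ = 3/2
+ 2θ in place of -2s, the gain leaves growth (x² + y²)^{3/2} in the inputs, which the Jacobian can
pay for. As θ < 1 this reaches every -2s < 7/2, that is s > -7/4. -/

namespace Kawahara

open scoped ENNReal FourierTransform

/-! ### Brackets and their convolution -/

/-- The negative power `⟨y⟩^{-c}` of the bracket. -/
noncomputable def decay (c y : ℝ) : ℝ≥0∞ := ENNReal.ofReal ((1 + |y|) ^ (-c))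

theorem measurable_decay (c : ℝ) : Measurable (decay c) := by
  unfold decay
  fun_prop

theorem decay_neg (c y : ℝ) : decay c (-y) = decay c y := by simp [decay]

theorem decay_le_one {c : ℝ} (hc : 0 ≤ c) (y : ℝ) : decay c y ≤ 1 := by
  unfold decay
  rw [ENNReal.ofReal_le_one]
  exact Real.rpow_le_one_of_one_le_of_nonpos (by simp) (by linarith)

theorem lintegral_decay_lt_top {c : ℝ} (hc : 1 < c) : ∫⁻ y, decay c y < ⊤ := by
  have h : Integrable (fun y : ℝ => (1 + ‖y‖) ^ (-c)) :=
    integrable_one_add_norm (by simpa using hc)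
  exact h.lintegral_lt_top

theorem lintegral_decay_sub (c a : ℝ) : ∫⁻ y, decay c (a - y) = ∫⁻ y, decay c y :=
  lintegral_sub_left_eq_self (decay c) a

/-- The larger of |t| and |a - t| is at least |a|/2, so its factor is comparable to the bracket of
a; the other factor is kept for integration. -/
theorem decay_mul_decay_le {c : ℝ} (hc : 0 ≤ c) (a t : ℝ) :
    decay c t * decay c (a - t) ≤
      ENNReal.ofReal (2 ^ c) * decay c a * (decay c t + decay c (a - t)) := by
  have key : ∀ x y : ℝ, |y| ≤ |x| →
      decay c x ≤ ENNReal.ofReal (2 ^ c) * decay c (x + y) := by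
    intro x y h
    unfold decay
    rw [← ENNReal.ofReal_mul (by positivity)]
    refine ENNReal.ofReal_le_ofReal ?_
    have h1 : (1 + |x + y|) / 2 ≤ 1 + |x| := by
      have := abs_add_le x y
      have := abs_nonneg x
      linarith
    calc (1 + |x|) ^ (-c) ≤ ((1 + |x + y|) / 2) ^ (-c) :=
          Real.rpow_le_rpow_of_nonpos (by positivity) h1 (by linarith)
      _ = 2 ^ c * (1 + |x + y|) ^ (-c) := by
          rw [Real.div_rpow (by positivity) (by norm_num), Real.rpow_neg (by norm_num : (0:ℝ) ≤ 2)]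
          field_simp
  rcases le_total |a - t| |t| with h | h
  · have := key t (a - t) h
    rw [add_sub_cancel] at this
    calc decay c t * decay c (a - t) ≤ ENNReal.ofReal (2 ^ c) * decay c a * decay c (a - t) := by
          gcongr
      _ ≤ _ := by gcongr; exact le_add_self
  · have := key (a - t) t h
    rw [sub_add_cancel] at this
    calc decay c t * decay c (a - t) ≤ decay c t * (ENNReal.ofReal (2 ^ c) * decay c a) := by
          gcongr
      _ = ENNReal.ofReal (2 ^ c) * decay c a * decay c t := by ring
      _ ≤ _ := by gcongr; exact le_self_add

theorem lintegral_decay_mul_decay {c : ℝ} (hc : 0 ≤ c) (a : ℝ) :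
    ∫⁻ t, decay c t * decay c (a - t) ≤
      ENNReal.ofReal (2 ^ c) * (2 * ∫⁻ t, decay c t) * decay c a := by
  calc ∫⁻ t, decay c t * decay c (a - t)
      ≤ ∫⁻ t, ENNReal.ofReal (2 ^ c) * decay c a * (decay c t + decay c (a - t)) :=
        lintegral_mono fun t => decay_mul_decay_le hc a t
    _ = ENNReal.ofReal (2 ^ c) * decay c a * (∫⁻ t, decay c t + decay c (a - t)) :=
        lintegral_const_mul' _ _ (ENNReal.mul_ne_top ENNReal.ofReal_ne_top ENNReal.ofReal_ne_top)
    _ = _ := by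
        rw [lintegral_add_left (measurable_decay c), lintegral_decay_sub]
        ring

/-! ### The sum of two phases as a change of variables -/

/-- The sum of squares of two frequencies `x` and `η - x` with sum `η`. -/
def sqSum (η x : ℝ) : ℝ := x ^ 2 + (η - x) ^ 2

theorem sqSum_nonneg (η x : ℝ) : 0 ≤ sqSum η x := by unfold sqSum; positivity

/-- The sum of the phases of two frequencies `x` and `η - x` with sum `η`. -/
def phaseSum (α β η x : ℝ) : ℝ := phase α β x + phase α β (η - x)

theorem hasDerivAt_phaseSum (α β η x : ℝ) :
    HasDerivAt (phaseSum α β η) (η * (2 * x - η) * (3 * α - 5 * β * sqSum η x)) x := by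
  have h : phaseSum α β η = fun x => (-β * x ^ 5 + α * x ^ 3) +
      (-β * (η - x) ^ 5 + α * (η - x) ^ 3) := rfl
  rw [h]
  have h1 : HasDerivAt (fun x : ℝ => η - x) (-1) x := by
    simpa using (hasDerivAt_id x).const_sub η
  have h2 := ((((hasDerivAt_id x).pow 5).const_mul (-β)).add
    (((hasDerivAt_id x).pow 3).const_mul α)).add
    (((h1.pow 5).const_mul (-β)).add ((h1.pow 3).const_mul α))
  refine h2.congr_deriv ?_
  simp only [sqSum, id]
  push_cast
  ring

/-- For fixed η the phase sum is a quadratic polynomial in (x - η/2)². Factoring its difference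
gives injectivity directly, without a monotonicity argument on a possibly disconnected set. -/
theorem phaseSum_sub (α β η x y : ℝ) :
    phaseSum α β η x - phaseSum α β η y =
      ((x - η / 2) ^ 2 - (y - η / 2) ^ 2) * η *
        (3 * α - 5 / 2 * β * (sqSum η x + sqSum η y)) := by
  simp only [phaseSum, phase, sqSum]
  ring

/-- Beyond the threshold M² the cubic term costs at most 4|β|q out of 5|β|q, so the last factor of
the derivative of `phaseSum` stays away from zero. -/
theorem abs_le_of_large {α β M q : ℝ} (hM : 3 * |α| ≤ 4 * |β| * M ^ 2) (hq : M ^ 2 ≤ q) :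
    |β| * q ≤ |3 * α - 5 * β * q| := by
  have hq0 : 0 ≤ q := (sq_nonneg M).trans hq
  have h1 : |5 * β * q| ≤ |3 * α - 5 * β * q| + |3 * α| := by
    calc |5 * β * q| = |3 * α - (3 * α - 5 * β * q)| := by congr 1; ring
      _ ≤ |3 * α| + |3 * α - 5 * β * q| := abs_sub _ _
      _ = _ := add_comm _ _
  rw [abs_mul, abs_mul, abs_mul, abs_of_nonneg hq0] at h1
  norm_num at h1
  have h2 : |β| * M ^ 2 ≤ |β| * q := by gcongr
  linarith

theorem injOn_phaseSum {α β M η : ℝ} (hβ : β ≠ 0) (hη : η ≠ 0) (hM0 : 0 < M)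
    (hM : 3 * |α| ≤ 4 * |β| * M ^ 2) (S : Set ℝ)
    (hS : ∀ x ∈ S, ∀ y ∈ S, (x - η / 2) ^ 2 = (y - η / 2) ^ 2 → x = y) :
    Set.InjOn (phaseSum α β η) ({x | M ^ 2 ≤ sqSum η x} ∩ S) := by
  rintro x ⟨hx, hxS⟩ y ⟨hy, hyS⟩ hxy
  refine hS x hxS y hyS ?_
  have h := phaseSum_sub α β η x y
  rw [hxy, sub_self, eq_comm, mul_eq_zero, mul_eq_zero] at h
  have hq : M ^ 2 ≤ (sqSum η x + sqSum η y) / 2 := by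
    have : M ^ 2 ≤ sqSum η x := hx
    have : M ^ 2 ≤ sqSum η y := hy
    linarith
  have hne : 3 * α - 5 / 2 * β * (sqSum η x + sqSum η y) ≠ 0 := by
    have h1 := abs_le_of_large hM hq
    have h2 : 0 < |β| * ((sqSum η x + sqSum η y) / 2) :=
      mul_pos (abs_pos.2 hβ) (lt_of_lt_of_le (by positivity) hq)
    intro h0
    have : 3 * α - 5 * β * ((sqSum η x + sqSum η y) / 2) = 0 := by linarith
    rw [this, abs_zero] at h1
    linarith
  rcases h with (h | h) | h
  · linarith
  · exact absurd h hη
  · exact absurd h hne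

theorem measurableSet_large (M η : ℝ) : MeasurableSet {x | M ^ 2 ≤ sqSum η x} := by
  unfold sqSum
  exact measurableSet_le measurable_const (by fun_prop)

/-- Change of variables `μ = p(x) + p(η - x)` on a set on which it is injective. -/
theorem setLIntegral_jacobian_le {α β M η : ℝ} (hβ : β ≠ 0) (hη : η ≠ 0) (hM0 : 0 < M)
    (hM : 3 * |α| ≤ 4 * |β| * M ^ 2) (c a : ℝ) (S : Set ℝ) (hSm : MeasurableSet S)
    (hS : ∀ x ∈ S, ∀ y ∈ S, (x - η / 2) ^ 2 = (y - η / 2) ^ 2 → x = y) :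
    ∫⁻ x in {x | M ^ 2 ≤ sqSum η x} ∩ S,
        ENNReal.ofReal (|η| * |2 * x - η| * sqSum η x) * decay c (a - phaseSum α β η x) ≤
      ENNReal.ofReal |β|⁻¹ * ∫⁻ y, decay c y := by
  set E := {x | M ^ 2 ≤ sqSum η x} ∩ S
  have hE : MeasurableSet E := (measurableSet_large M η).inter hSm
  have hβ' : 0 < |β| := abs_pos.2 hβ
  calc ∫⁻ x in E,
        ENNReal.ofReal (|η| * |2 * x - η| * sqSum η x) * decay c (a - phaseSum α β η x)
      ≤ ∫⁻ x in E, ENNReal.ofReal |β|⁻¹ *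
          (ENNReal.ofReal |η * (2 * x - η) * (3 * α - 5 * β * sqSum η x)| *
            decay c (a - phaseSum α β η x)) := by
        refine setLIntegral_mono' hE fun x hx => ?_
        have hq0 := sqSum_nonneg η x
        rw [← mul_assoc, ← ENNReal.ofReal_mul (by positivity)]
        gcongr ENNReal.ofReal ?_ * _
        rw [abs_mul, abs_mul]
        have h1 := abs_le_of_large hM (show M ^ 2 ≤ sqSum η x from hx.1)
        have h2 : sqSum η x ≤ |β|⁻¹ * |3 * α - 5 * β * sqSum η x| := by
          rw [inv_mul_eq_div, le_div_iff₀ hβ']; linarith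
        calc |η| * |2 * x - η| * sqSum η x
            ≤ |η| * |2 * x - η| * (|β|⁻¹ * |3 * α - 5 * β * sqSum η x|) := by gcongr
          _ = _ := by ring
    _ = ENNReal.ofReal |β|⁻¹ * ∫⁻ x in E,
          (ENNReal.ofReal |η * (2 * x - η) * (3 * α - 5 * β * sqSum η x)| *
            decay c (a - phaseSum α β η x)) :=
        lintegral_const_mul' _ _ ENNReal.ofReal_ne_top
    _ = ENNReal.ofReal |β|⁻¹ * ∫⁻ y in phaseSum α β η '' E, decay c (a - y) := by
        rw [lintegral_image_eq_lintegral_abs_deriv_mul hE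
          (fun x _ => (hasDerivAt_phaseSum α β η x).hasDerivWithinAt)
          (injOn_phaseSum hβ hη hM0 hM S hS)]
    _ ≤ ENNReal.ofReal |β|⁻¹ * ∫⁻ y, decay c (a - y) := by
        gcongr; exact Measure.restrict_le_self
    _ = _ := by rw [lintegral_decay_sub]

/-- On each side of the critical point η/2 the square (x - η/2)² determines x, so the substitution
applies on both half-lines; this is the factor 2. -/
theorem lintegral_jacobian_le {α β M : ℝ} (hβ : β ≠ 0) (hM0 : 0 < M)
    (hM : 3 * |α| ≤ 4 * |β| * M ^ 2) (c a η : ℝ) :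
    ∫⁻ x in {x | M ^ 2 ≤ sqSum η x},
        ENNReal.ofReal (|η| * |2 * x - η| * sqSum η x) * decay c (a - phaseSum α β η x) ≤
      2 * (ENNReal.ofReal |β|⁻¹ * ∫⁻ y, decay c y) := by
  rcases eq_or_ne η 0 with rfl | hη
  · simp
  have h1 := setLIntegral_jacobian_le hβ hη hM0 hM c a (Set.Ici (η / 2)) measurableSet_Ici
    (fun x hx y hy h => by
      have hx' : η / 2 ≤ x := hx
      have hy' : η / 2 ≤ y := hy
      have := (sq_eq_sq₀ (sub_nonneg.2 hx') (sub_nonneg.2 hy')).1 h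
      linarith)
  have h2 := setLIntegral_jacobian_le hβ hη hM0 hM c a (Set.Iic (η / 2)) measurableSet_Iic
    (fun x hx y hy h => by
      have hx' : x ≤ η / 2 := hx
      have hy' : y ≤ η / 2 := hy
      have := (sq_eq_sq₀ (sub_nonneg.2 hx') (sub_nonneg.2 hy')).1 (by linarith)
      linarith)
  have hu : {x | M ^ 2 ≤ sqSum η x} =
      ({x | M ^ 2 ≤ sqSum η x} ∩ Set.Ici (η / 2)) ∪ ({x | M ^ 2 ≤ sqSum η x} ∩ Set.Iic (η / 2)) := by
    rw [← Set.inter_union_distrib_left, Set.union_comm, Set.Iic_union_Ici, Set.inter_univ]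
  rw [hu, two_mul]
  exact (lintegral_union_le _ _ _).trans (add_le_add h1 h2)

/-! ### The multiplier and its uniform integral bound -/

/-- The multiplier that is controlled by one integration over a frequency: the Jacobian of
`phaseSum` at large frequencies, a short interval around its critical point, and a bounded set. -/
noncomputable def multiplier (M η x : ℝ) : ℝ :=
  (if M ^ 2 ≤ sqSum η x then |η| * |2 * x - η| * sqSum η x else 0) +
    (if |2 * x - η| * (1 + |η|) ≤ 1 then 1 + |η| else 0) +
    (if sqSum η x ≤ M ^ 2 then 1 else 0)

theorem measurable_multiplier (M : ℝ) : Measurable (fun w : ℝ × ℝ => multiplier M w.1 w.2) := by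
  unfold multiplier sqSum
  refine ((Measurable.ite ?_ ?_ measurable_const).add
    (Measurable.ite ?_ ?_ measurable_const)).add
    (Measurable.ite ?_ measurable_const measurable_const)
  · exact measurableSet_le measurable_const (by fun_prop)
  · fun_prop
  · exact measurableSet_le (by fun_prop) measurable_const
  · fun_prop
  · exact measurableSet_le (by fun_prop) measurable_const

theorem multiplier_nonneg (M η x : ℝ) : 0 ≤ multiplier M η x := by
  unfold multiplier
  have := sqSum_nonneg η x
  positivity

/-- One summand per piece: the change of variables; height 1 + |η| on an interval of length at most
1/(1 + |η|); and a subset of [-M, M]. The last two only use that `decay` is at most 1. -/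
theorem lintegral_multiplier_le {α β M c : ℝ} (hβ : β ≠ 0) (hM0 : 0 < M)
    (hM : 3 * |α| ≤ 4 * |β| * M ^ 2) (hc : 0 ≤ c) (η a : ℝ) :
    ∫⁻ x, ENNReal.ofReal (multiplier M η x) * decay c (a - phaseSum α β η x) ≤
      2 * (ENNReal.ofReal |β|⁻¹ * ∫⁻ y, decay c y) + 1 + ENNReal.ofReal (2 * M) := by
  have hm1 := measurableSet_large M η
  have hm2 : MeasurableSet {x : ℝ | |2 * x - η| * (1 + |η|) ≤ 1} :=
    measurableSet_le (by fun_prop) measurable_const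
  have hm3 : MeasurableSet {x | sqSum η x ≤ M ^ 2} := by
    unfold sqSum
    exact measurableSet_le (by fun_prop) measurable_const
  have hphase : Measurable (phaseSum α β η) := by
    unfold phaseSum phase
    fun_prop
  have hd : Measurable fun x => decay c (a - phaseSum α β η x) :=
    (measurable_decay c).comp (measurable_const.sub hphase)
  have hq : Measurable (sqSum η) := by
    unfold sqSum
    fun_prop
  calc ∫⁻ x, ENNReal.ofReal (multiplier M η x) * decay c (a - phaseSum α β η x)
      ≤ ∫⁻ x, ({x | M ^ 2 ≤ sqSum η x}.indicator (fun x =>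
            ENNReal.ofReal (|η| * |2 * x - η| * sqSum η x) * decay c (a - phaseSum α β η x)) x +
          {x : ℝ | |2 * x - η| * (1 + |η|) ≤ 1}.indicator
            (fun _ => ENNReal.ofReal (1 + |η|)) x) +
          {x | sqSum η x ≤ M ^ 2}.indicator (fun _ => 1) x := by
        refine lintegral_mono fun x => ?_
        have hq0 := sqSum_nonneg η x
        have hd1 := decay_le_one hc (a - phaseSum α β η x)
        simp only [multiplier, Set.indicator, Set.mem_ofPred_eq]
        rw [ENNReal.ofReal_add (by positivity) (by positivity),
          ENNReal.ofReal_add (by positivity) (by positivity), add_mul, add_mul]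
        refine add_le_add (add_le_add ?_ ?_) ?_
        · split_ifs <;> simp
        · split_ifs
          · exact mul_le_of_le_one_right' hd1
          · simp
        · split_ifs
          · simpa using hd1
          · simp
    _ = (∫⁻ x in {x | M ^ 2 ≤ sqSum η x},
            ENNReal.ofReal (|η| * |2 * x - η| * sqSum η x) * decay c (a - phaseSum α β η x)) +
          ENNReal.ofReal (1 + |η|) * volume {x : ℝ | |2 * x - η| * (1 + |η|) ≤ 1} +
          volume {x | sqSum η x ≤ M ^ 2} := by
        rw [lintegral_add_left, lintegral_add_left, lintegral_indicator hm1,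
          lintegral_indicator_const hm2, lintegral_indicator_const hm3, one_mul]
        · refine Measurable.indicator (Measurable.mul ?_ hd) hm1
          fun_prop
        · refine Measurable.add (Measurable.indicator (Measurable.mul ?_ hd) hm1)
            (measurable_const.indicator hm2)
          fun_prop
    _ ≤ _ := by
        refine add_le_add (add_le_add (lintegral_jacobian_le hβ hM0 hM c a η) ?_) ?_
        · have hpos : 0 < 1 + |η| := by positivity
          have hsub : {x : ℝ | |2 * x - η| * (1 + |η|) ≤ 1} ⊆
              Set.Icc (η / 2 - (1 + |η|)⁻¹ / 2) (η / 2 + (1 + |η|)⁻¹ / 2) := by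
            intro x hx
            have h1 : |2 * x - η| ≤ (1 + |η|)⁻¹ := by
              rw [← one_div, le_div_iff₀ hpos]; exact hx
            have h2 := abs_le.1 h1
            constructor <;> linarith [h2.1, h2.2]
          calc ENNReal.ofReal (1 + |η|) * volume {x : ℝ | |2 * x - η| * (1 + |η|) ≤ 1}
              ≤ ENNReal.ofReal (1 + |η|) * ENNReal.ofReal ((1 + |η|)⁻¹) := by
                gcongr
                refine (measure_mono hsub).trans ?_
                rw [Real.volume_Icc]
                exact ENNReal.ofReal_le_ofReal (by linarith)
            _ = 1 := by
                rw [← ENNReal.ofReal_mul hpos.le, mul_inv_cancel₀ hpos.ne', ENNReal.ofReal_one]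
        · have hsub : {x | sqSum η x ≤ M ^ 2} ⊆ Set.Icc (-M) M := by
            intro x hx
            have h1 : x ^ 2 + (η - x) ^ 2 ≤ M ^ 2 := hx
            exact abs_le.1 (abs_le_of_sq_le_sq (by nlinarith [sq_nonneg (η - x)]) hM0.le)
          refine (measure_mono hsub).trans ?_
          rw [Real.volume_Icc]
          exact ENNReal.ofReal_le_ofReal (by linarith)

/-- The kernel with modulations `t - p(x)` and `a - t - p(η - x)` for `w = (η, a)`, `z = (x, t)`. -/
noncomputable def kernel (α β M c : ℝ) (w z : ℝ × ℝ) : ℝ≥0∞ :=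
  ENNReal.ofReal (multiplier M w.1 z.1) *
    (decay c (z.2 - phase α β z.1) * decay c (w.2 - z.2 - phase α β (w.1 - z.1)))

theorem measurable_kernel (α β M c : ℝ) :
    Measurable (fun q : (ℝ × ℝ) × (ℝ × ℝ) => kernel α β M c q.1 q.2) := by
  unfold kernel
  refine Measurable.mul ?_ (Measurable.mul ((measurable_decay c).comp ?_)
    ((measurable_decay c).comp ?_))
  · exact ((measurable_multiplier M).comp
      (f := fun q : (ℝ × ℝ) × (ℝ × ℝ) => (q.1.1, q.2.1)) (by fun_prop)).ennreal_ofReal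
  · unfold phase; fun_prop
  · unfold phase; fun_prop

theorem exists_lintegral_kernel_le {α β M c : ℝ} (hβ : β ≠ 0) (hM0 : 0 < M)
    (hM : 3 * |α| ≤ 4 * |β| * M ^ 2) (hc : 1 < c) :
    ∃ C : ℝ≥0∞, C ≠ ⊤ ∧ ∀ w, ∫⁻ z, kernel α β M c w z ≤ C := by
  have hI := (lintegral_decay_lt_top hc).ne
  refine ⟨(ENNReal.ofReal (2 ^ c) * (2 * ∫⁻ t, decay c t)) *
    (2 * (ENNReal.ofReal |β|⁻¹ * ∫⁻ y, decay c y) + 1 + ENNReal.ofReal (2 * M)), ?_, fun w => ?_⟩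
  · exact ENNReal.mul_ne_top (by finiteness) (by finiteness)
  have hk : Measurable (kernel α β M c w) :=
    Measurable.comp (g := fun q : (ℝ × ℝ) × (ℝ × ℝ) => kernel α β M c q.1 q.2)
      (f := fun z => (w, z)) (measurable_kernel α β M c) measurable_prodMk_left
  have hphase : Measurable (phase α β) := by unfold phase; fun_prop
  rw [Measure.volume_eq_prod, lintegral_prod _ hk.aemeasurable]
  have hK : ENNReal.ofReal (2 ^ c) * (2 * ∫⁻ t, decay c t) ≠ ⊤ := by finiteness
  have hconv := lintegral_decay_mul_decay (zero_le_one.trans hc.le)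
  generalize ENNReal.ofReal (2 ^ c) * (2 * ∫⁻ t, decay c t) = K at hK hconv ⊢
  calc ∫⁻ x, ∫⁻ t, kernel α β M c w (x, t)
      ≤ ∫⁻ x, K *
          (ENNReal.ofReal (multiplier M w.1 x) * decay c (w.2 - phaseSum α β w.1 x)) := by
        refine lintegral_mono fun x => ?_
        simp only [kernel]
        rw [lintegral_const_mul' _ _ ENNReal.ofReal_ne_top]
        have h := hconv (w.2 - phaseSum α β w.1 x)
        -- Shifting t by p(x) turns the product of the two modulations into the convolution already
        -- bounded.
        rw [← lintegral_sub_right_eq_self _ (phase α β x)] at h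
        have e : ∀ t, w.2 - phaseSum α β w.1 x - (t - phase α β x) =
            w.2 - t - phase α β (w.1 - x) := fun t => by
          simp only [phaseSum]; ring
        simp only [e] at h
        calc ENNReal.ofReal (multiplier M w.1 x) * ∫⁻ t, decay c (t - phase α β x) *
                decay c (w.2 - t - phase α β (w.1 - x))
            ≤ ENNReal.ofReal (multiplier M w.1 x) *
                (K * decay c (w.2 - phaseSum α β w.1 x)) := by gcongr
          _ = _ := mul_left_comm _ _ _
    _ = K * ∫⁻ x, ENNReal.ofReal (multiplier M w.1 x) *
          decay c (w.2 - phaseSum α β w.1 x) := lintegral_const_mul' _ _ hK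
    _ ≤ _ := by
        gcongr
        exact lintegral_multiplier_le hβ hM0 hM (zero_le_one.trans hc.le) w.1 w.2

theorem multiplier_reflect (M η x : ℝ) : multiplier M η (η - x) = multiplier M η x := by
  have h1 : sqSum η (η - x) = sqSum η x := by simp only [sqSum]; ring
  have h2 : |2 * (η - x) - η| = |2 * x - η| := by
    rw [← abs_neg]; congr 1; ring
  simp only [multiplier, h1, h2]

theorem jacobian_le_multiplier {M η x : ℝ} (h : M ^ 2 ≤ sqSum η x) :
    |η| * |2 * x - η| * sqSum η x ≤ multiplier M η x := by
  have := sqSum_nonneg η x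
  unfold multiplier
  rw [if_pos h, add_assoc]
  exact le_add_of_nonneg_right (by positivity)

theorem bracket_le_multiplier {M η x : ℝ} (h : |2 * x - η| * (1 + |η|) ≤ 1) :
    1 + |η| ≤ multiplier M η x := by
  have := sqSum_nonneg η x
  unfold multiplier
  rw [if_pos h, add_right_comm]
  exact le_add_of_nonneg_left (by positivity)

theorem one_le_multiplier {M η x : ℝ} (h : sqSum η x ≤ M ^ 2) : 1 ≤ multiplier M η x := by
  have := sqSum_nonneg η x
  unfold multiplier
  rw [if_pos h]
  exact le_add_of_nonneg_left (by positivity)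

/-! ### The frequency weight at bounded and low frequencies -/

/-- The frequency weight `ξ² ⟨ξ⟩^{-ρ} ⟨x⟩^ρ ⟨y⟩^ρ` with `ξ = x + y` and `ρ = 3/2 + 2θ`. -/
noncomputable def freqWeight (θ x y : ℝ) : ℝ :=
  (x + y) ^ 2 * (1 + |x + y|) ^ (-(3 / 2 + 2 * θ)) *
    ((1 + |x|) ^ (3 / 2 + 2 * θ) * (1 + |y|) ^ (3 / 2 + 2 * θ))

theorem freqWeight_nonneg (θ x y : ℝ) : 0 ≤ freqWeight θ x y := by
  unfold freqWeight; positivity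

theorem freqWeight_comm (θ x y : ℝ) : freqWeight θ x y = freqWeight θ y x := by
  unfold freqWeight; rw [add_comm x y]; ring

theorem freqWeight_le_of_bounded {θ M x y : ℝ} (hθ0 : 0 ≤ θ) (hM : 0 ≤ M)
    (h : x ^ 2 + y ^ 2 ≤ M ^ 2) :
    freqWeight θ x y ≤
      2 * M ^ 2 * ((1 + M) ^ (3 / 2 + 2 * θ) * (1 + M) ^ (3 / 2 + 2 * θ)) := by
  have hx : |x| ≤ M := abs_le_of_sq_le_sq (by nlinarith [sq_nonneg y]) hM
  have hy : |y| ≤ M := abs_le_of_sq_le_sq (by nlinarith [sq_nonneg x]) hM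
  have h1 : (x + y) ^ 2 ≤ 2 * M ^ 2 := by nlinarith [sq_nonneg (x - y)]
  have h2 : (1 + |x + y|) ^ (-(3 / 2 + 2 * θ)) ≤ 1 :=
    Real.rpow_le_one_of_one_le_of_nonpos (by simp) (by linarith)
  unfold freqWeight
  calc _ ≤ 2 * M ^ 2 * 1 * ((1 + M) ^ (3 / 2 + 2 * θ) * (1 + M) ^ (3 / 2 + 2 * θ)) := by
        gcongr
    _ = _ := by ring

/-- When x is low, ⟨y⟩ and ⟨x + y⟩ are comparable and their powers cancel, leaving only the
derivative squared. -/
theorem freqWeight_le_of_low {θ x y : ℝ} (hθ0 : 0 ≤ θ) (hx : |x| ≤ 1) :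
    freqWeight θ x y ≤ 4 ^ (3 / 2 + 2 * θ) * (x + y) ^ 2 := by
  set ρ := 3 / 2 + 2 * θ with hρ
  have hρ0 : 0 ≤ ρ := by linarith
  have h1 : 1 + |x| ≤ 2 := by linarith
  have h2 : 1 + |y| ≤ 2 * (1 + |x + y|) := by
    have : |y| ≤ |x + y| + |x| := by
      calc |y| = |(x + y) - x| := by congr 1; ring
        _ ≤ _ := abs_sub _ _
    have := abs_nonneg (x + y)
    linarith
  unfold freqWeight
  rw [← hρ]
  calc (x + y) ^ 2 * (1 + |x + y|) ^ (-ρ) * ((1 + |x|) ^ ρ * (1 + |y|) ^ ρ)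
      ≤ (x + y) ^ 2 * (1 + |x + y|) ^ (-ρ) * (2 ^ ρ * (2 * (1 + |x + y|)) ^ ρ) := by gcongr
    _ = (2 ^ ρ * 2 ^ ρ) * ((1 + |x + y|) ^ (-ρ) * (1 + |x + y|) ^ ρ) * (x + y) ^ 2 := by
        rw [Real.mul_rpow (by norm_num) (by positivity)]; ring
    _ = _ := by
        rw [← Real.mul_rpow (by norm_num) (by norm_num), ← Real.rpow_add (by positivity),
          neg_add_cancel, Real.rpow_zero]
        norm_num

/-- A low and a high frequency are well separated, so the Jacobian is far from degenerate and pays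
for the derivative with no help from the resonance. -/
theorem sq_le_multiplier_of_low {M x y : ℝ} (hM : 4 ≤ M) (hx : |x| ≤ 1)
    (hQ : M ^ 2 ≤ x ^ 2 + y ^ 2) : (x + y) ^ 2 ≤ multiplier M (x + y) x := by
  have e : sqSum (x + y) x = x ^ 2 + y ^ 2 := by simp only [sqSum]; ring
  refine le_trans ?_ (jacobian_le_multiplier (by rw [e]; exact hQ))
  have e2 : |2 * x - (x + y)| = |x - y| := by congr 1; ring
  rw [e, e2]
  have hx2 : x ^ 2 ≤ 1 := by nlinarith [abs_nonneg x, sq_abs x]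
  have hy : 3 ≤ |y| := by
    by_contra! hcon
    nlinarith [abs_nonneg y, sq_abs y]
  have h1 : 2 ≤ |x - y| := by
    have := abs_sub_abs_le_abs_sub y x
    rw [abs_sub_comm] at this
    linarith
  have h2 : 2 ≤ |x + y| := by
    have := abs_sub_abs_le_abs_sub y (-x)
    rw [abs_neg, sub_neg_eq_add, add_comm y x] at this
    linarith
  have h3 : |x + y| ^ 2 ≤ 2 * (x ^ 2 + y ^ 2) := by
    rw [sq_abs]; nlinarith [sq_nonneg (x - y)]
  calc (x + y) ^ 2 = |x + y| * |x + y| := by rw [← sq, sq_abs]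
    _ ≤ |x + y| * (2 * (x ^ 2 + y ^ 2)) := by gcongr; nlinarith
    _ ≤ |x + y| * (|x - y| * (x ^ 2 + y ^ 2)) := by gcongr
    _ = _ := by ring

/-! ### Resonance and the multiplier at high frequencies -/

/-- The resonance function `p(x) + p(y) - p(x + y)`. -/
def resonance (α β x y : ℝ) : ℝ := phase α β x + phase α β y - phase α β (x + y)

/-- The resonance factors as (x + y)xy times 5β(x² + xy + y²) - 3α. Since x² + xy + y² ≥ (x² +
y²)/2, the quintic part is at least 5/2 |β|(x² + y²), of which the cubic part takes at most 2. -/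
theorem le_abs_resonance {α β M x y : ℝ} (hM : 3 * |α| ≤ 2 * |β| * M ^ 2)
    (hQ : M ^ 2 ≤ x ^ 2 + y ^ 2) :
    |β| / 2 * (|x + y| * (|x| * |y|) * (x ^ 2 + y ^ 2)) ≤ |resonance α β x y| := by
  have e : resonance α β x y =
      (x + y) * (x * y) * (5 * β * (x ^ 2 + x * y + y ^ 2) - 3 * α) := by
    simp only [resonance, phase]; ring
  rw [e, abs_mul, abs_mul, abs_mul]
  have hS : (x ^ 2 + y ^ 2) / 2 ≤ x ^ 2 + x * y + y ^ 2 := by nlinarith [sq_nonneg (x + y)]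
  have hS0 : 0 ≤ x ^ 2 + x * y + y ^ 2 := le_trans (by positivity) hS
  have h1 := abs_sub_abs_le_abs_sub (5 * β * (x ^ 2 + x * y + y ^ 2)) (3 * α)
  rw [abs_mul, abs_mul, abs_mul, abs_of_nonneg hS0] at h1
  norm_num at h1
  have h2 : |β| * M ^ 2 ≤ |β| * (x ^ 2 + y ^ 2) := by gcongr
  have h3 : |β| * ((x ^ 2 + y ^ 2) / 2) ≤ |β| * (x ^ 2 + x * y + y ^ 2) := by gcongr
  have h4 : |β| / 2 * (x ^ 2 + y ^ 2) ≤ |5 * β * (x ^ 2 + x * y + y ^ 2) - 3 * α| := by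
    linarith
  calc |β| / 2 * (|x + y| * (|x| * |y|) * (x ^ 2 + y ^ 2))
      = |x + y| * (|x| * |y|) * (|β| / 2 * (x ^ 2 + y ^ 2)) := by ring
    _ ≤ _ := by gcongr

/-- The resonance gain at high frequencies. -/
theorem freqWeight_mul_resonance_le {α β M θ x y : ℝ} (hβ : β ≠ 0) (hθ : 5 / 6 ≤ θ) (hθ1 : θ < 1)
    (hM1 : 1 ≤ M) (hM : 3 * |α| ≤ 2 * |β| * M ^ 2) (hx : 1 ≤ |x|) (hy : 1 ≤ |y|)
    (hQ : M ^ 2 ≤ x ^ 2 + y ^ 2) :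
    freqWeight θ x y * (1 + |resonance α β x y|) ^ (-θ) * (1 + |x + y|) ^ 3 ≤
      4 ^ (3 / 2 + 2 * θ) * (|β| / 2) ^ (-θ) * (|x + y| * √(x ^ 2 + y ^ 2) ^ 3) := by
  set Q := x ^ 2 + y ^ 2 with hQdef
  set a := |x + y| with ha
  set P := |x| * |y| with hP
  have hβ' : 0 < |β| / 2 := by have := abs_pos.2 hβ; positivity
  have hQ0 : 0 < Q := lt_of_lt_of_le (by positivity) hQ
  have hP1 : 1 ≤ P := one_le_mul_of_one_le_of_one_le hx hy
  have hPQ : P ≤ Q := by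
    rw [hP, hQdef, ← sq_abs x, ← sq_abs y]
    nlinarith [sq_nonneg (|x| - |y|), sq_nonneg (|x| + |y|), abs_nonneg x, abs_nonneg y]
  rcases (abs_nonneg (x + y)).eq_or_lt with h0 | h0
  · have : x + y = 0 := abs_eq_zero.1 h0.symm
    simp [freqWeight, this, ha]
  have ha0 : 0 < a := h0
  have hsq : (x + y) ^ 2 = a ^ 2 := (sq_abs _).symm
  set ρ := 3 / 2 + 2 * θ with hρ
  have hJ : (1 + |x|) ^ ρ * (1 + |y|) ^ ρ ≤ 4 ^ ρ * P ^ ρ := by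
    rw [← Real.mul_rpow (by positivity) (by positivity),
      ← Real.mul_rpow (by positivity) (by positivity)]
    refine Real.rpow_le_rpow (by positivity) ?_ (by linarith)
    rw [hP]; nlinarith
  have hres : (1 + |resonance α β x y|) ^ (-θ) ≤
      (|β| / 2) ^ (-θ) * (a ^ (-θ) * P ^ (-θ) * Q ^ (-θ)) := by
    rw [← Real.mul_rpow ha0.le (by positivity), ← Real.mul_rpow (by positivity) hQ0.le,
      ← Real.mul_rpow hβ'.le (by positivity)]
    refine Real.rpow_le_rpow_of_nonpos (by positivity) ?_ (by linarith)
    have := le_abs_resonance hM hQ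
    linarith
  -- The choice of ρ enters here: ρ - 2θ = 3/2.
  have hPQ' : P ^ ρ * P ^ (-θ) * Q ^ (-θ) ≤ √Q ^ 3 := by
    have hQ32 : √Q ^ 3 = Q ^ (3 / 2 : ℝ) := by
      rw [Real.sqrt_eq_rpow, ← Real.rpow_natCast, ← Real.rpow_mul hQ0.le]; norm_num
    rw [hQ32, ← Real.rpow_add (by positivity)]
    calc P ^ (ρ + -θ) * Q ^ (-θ) ≤ Q ^ (ρ + -θ) * Q ^ (-θ) := by gcongr; linarith
      _ = Q ^ (3 / 2 : ℝ) := by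
        rw [← Real.rpow_add hQ0, hρ]; congr 1; ring
  have haa : a ^ 2 * (1 + a) ^ (-ρ) * a ^ (-θ) * (1 + a) ^ 3 ≤ a := by
    have e1 : a ^ 2 * a ^ (-θ) = a * a ^ (1 - θ) := by
      rw [← Real.rpow_natCast, ← Real.rpow_add ha0]
      nth_rw 2 [← Real.rpow_one a]
      rw [← Real.rpow_add ha0]; congr 1; push_cast; ring
    -- The total exponent is 5/2 - 3θ, which is where 5/6 ≤ θ comes from.
    have e2 : (1 + a) ^ (1 - θ) * (1 + a) ^ (-ρ) * (1 + a) ^ 3 ≤ 1 := by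
      rw [← Real.rpow_natCast, ← Real.rpow_add (by positivity), ← Real.rpow_add (by positivity)]
      refine Real.rpow_le_one_of_one_le_of_nonpos (by linarith) ?_
      push_cast; linarith
    calc a ^ 2 * (1 + a) ^ (-ρ) * a ^ (-θ) * (1 + a) ^ 3
        = a * (a ^ (1 - θ) * (1 + a) ^ (-ρ) * (1 + a) ^ 3) := by
          rw [mul_right_comm (a ^ 2), e1]; ring
      _ ≤ a * ((1 + a) ^ (1 - θ) * (1 + a) ^ (-ρ) * (1 + a) ^ 3) := by
          gcongr
          linarith
      _ ≤ a * 1 := by gcongr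
      _ = a := mul_one a
  unfold freqWeight
  rw [hsq, ← hρ]
  calc a ^ 2 * (1 + a) ^ (-ρ) * ((1 + |x|) ^ ρ * (1 + |y|) ^ ρ) *
        (1 + |resonance α β x y|) ^ (-θ) * (1 + a) ^ 3
      ≤ a ^ 2 * (1 + a) ^ (-ρ) * (4 ^ ρ * P ^ ρ) *
        ((|β| / 2) ^ (-θ) * (a ^ (-θ) * P ^ (-θ) * Q ^ (-θ))) * (1 + a) ^ 3 := by gcongr
    _ = 4 ^ ρ * (|β| / 2) ^ (-θ) * ((a ^ 2 * (1 + a) ^ (-ρ) * a ^ (-θ) * (1 + a) ^ 3) *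
          (P ^ ρ * P ^ (-θ) * Q ^ (-θ))) := by ring
    _ ≤ _ := by gcongr

/-- With a = |x + y|, d = |x - y| and N² = x² + y², one has d² + a² = 2N². If d ≥ N the Jacobian
adN² dominates aN³. Otherwise N ≤ a, the factor (1 + a)³ cuts W down to a, and either the interval
term covers it or ad ≥ 1/2 and the Jacobian does. -/
theorem le_multiplier_output {M W x y : ℝ} (hM : 1 ≤ M) (hQ : M ^ 2 ≤ x ^ 2 + y ^ 2)
    (hW : W * (1 + |x + y|) ^ 3 ≤ |x + y| * √(x ^ 2 + y ^ 2) ^ 3) :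
    W ≤ 4 * multiplier M (x + y) x := by
  have hsq : sqSum (x + y) x = x ^ 2 + y ^ 2 := by simp only [sqSum]; ring
  have hN2 : √(x ^ 2 + y ^ 2) ^ 2 = x ^ 2 + y ^ 2 := Real.sq_sqrt (by positivity)
  have hN0 := Real.sqrt_nonneg (x ^ 2 + y ^ 2)
  have hjac : |x + y| * |2 * x - (x + y)| * sqSum (x + y) x ≤ multiplier M (x + y) x :=
    jacobian_le_multiplier (by rw [hsq]; exact hQ)
  have hda : |2 * x - (x + y)| ^ 2 + |x + y| ^ 2 = 2 * √(x ^ 2 + y ^ 2) ^ 2 := by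
    rw [hN2, sq_abs, sq_abs]; ring
  have hm0 := multiplier_nonneg M (x + y) x
  have hbr := bracket_le_multiplier (M := M) (η := x + y) (x := x)
  have ha0 := abs_nonneg (x + y)
  have hd0 := abs_nonneg (2 * x - (x + y))
  have hN1 : 1 ≤ √(x ^ 2 + y ^ 2) := by
    rw [Real.one_le_sqrt]; nlinarith
  rw [hsq, ← hN2] at hjac
  generalize √(x ^ 2 + y ^ 2) = N at *
  generalize |x + y| = a at *
  generalize |2 * x - (x + y)| = d at *
  generalize multiplier M (x + y) x = m at *
  have hpow : 1 ≤ (1 + a) ^ 3 := one_le_pow₀ (by linarith)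
  rcases le_or_gt W 0 with hW0 | hW0
  · linarith
  rcases le_total N d with h | h
  · have h1 : W ≤ W * (1 + a) ^ 3 := le_mul_of_one_le_right hW0.le hpow
    have h2 : a * N ^ 3 ≤ a * d * N ^ 2 := by
      calc a * N ^ 3 = a * N * N ^ 2 := by ring
        _ ≤ a * d * N ^ 2 := by gcongr
    linarith
  · have haN : N ≤ a := by
      refine abs_le_of_sq_le_sq' ?_ ha0 |>.2
      nlinarith
    have hWa : W ≤ a := by
      have h1 : W * (1 + a) ^ 3 ≤ a * (1 + a) ^ 3 := by
        refine hW.trans ?_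
        gcongr
        linarith
      exact le_of_mul_le_mul_right h1 (by positivity)
    by_cases hc : d * (1 + a) ≤ 1
    · have := hbr hc
      linarith
    · have h1 : 1 ≤ 2 * (a * d) := by nlinarith
      have h2 : a ≤ a * 1 * a := by nlinarith
      have h3 : a ^ 2 ≤ 2 * N ^ 2 := by nlinarith [sq_nonneg d]
      have h4 : N ^ 2 ≤ 2 * (a * d) * N ^ 2 := le_mul_of_one_le_left (by positivity) h1
      nlinarith

/-- The same dichotomy with the input x fixed, now for the pair x + y, -y with sum x. Away from the
critical point, |x| ≥ 1 makes the Jacobian at least of order N³. Near it N ≲ |x + y|, so (1 + |x +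
y|)³ reduces W to order N. Unlike the output case, N may be below M, which costs the term 6M³. -/
theorem le_multiplier_input {M W x y : ℝ} (hM : 1 ≤ M) (hx : 1 ≤ |x|)
    (hW : W * (1 + |x + y|) ^ 3 ≤ |x + y| * √(x ^ 2 + y ^ 2) ^ 3) :
    W ≤ (192 + 6 * M ^ 3) * multiplier M x (x + y) := by
  have hsq : sqSum x (x + y) = (x + y) ^ 2 + y ^ 2 := by simp only [sqSum]; ring
  have hN2 : √((x + y) ^ 2 + y ^ 2) ^ 2 = (x + y) ^ 2 + y ^ 2 := Real.sq_sqrt (by positivity)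
  have hN0 := Real.sqrt_nonneg ((x + y) ^ 2 + y ^ 2)
  -- The sharp constant is the golden ratio; 9/5 exceeds it and its cube is below 6.
  have hcmp : √(x ^ 2 + y ^ 2) ≤ 9 / 5 * √((x + y) ^ 2 + y ^ 2) := by
    refine Real.sqrt_le_iff.2 ⟨by positivity, ?_⟩
    rw [mul_pow, hN2]
    nlinarith [sq_nonneg (x + 2 * y), sq_nonneg (x + y), sq_nonneg y]
  have hW' : W * (1 + |x + y|) ^ 3 ≤ 6 * (|x + y| * √((x + y) ^ 2 + y ^ 2) ^ 3) := by
    refine hW.trans ?_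
    calc |x + y| * √(x ^ 2 + y ^ 2) ^ 3
        ≤ |x + y| * (9 / 5 * √((x + y) ^ 2 + y ^ 2)) ^ 3 := by gcongr
      _ = (9 / 5) ^ 3 * (|x + y| * √((x + y) ^ 2 + y ^ 2) ^ 3) := by ring
      _ ≤ _ := by gcongr; norm_num
  have hda : |2 * (x + y) - x| ^ 2 + |x| ^ 2 = 2 * √((x + y) ^ 2 + y ^ 2) ^ 2 := by
    rw [hN2, sq_abs, sq_abs]; ring
  have hae : |x| - |2 * (x + y) - x| ≤ 2 * |x + y| := by
    have h1 := abs_sub_abs_le_abs_sub x (-(2 * (x + y) - x))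
    have h2 : x - -(2 * (x + y) - x) = 2 * (x + y) := by ring
    rw [h2, abs_neg, abs_mul, abs_two] at h1
    exact h1
  have hm0 := multiplier_nonneg M x (x + y)
  have hbr := bracket_le_multiplier (M := M) (η := x) (x := x + y)
  have hone := one_le_multiplier (M := M) (η := x) (x := x + y)
  have hjac := jacobian_le_multiplier (M := M) (η := x) (x := x + y)
  have ha0 := abs_nonneg (x + y)
  have hd0 := abs_nonneg (2 * (x + y) - x)
  rw [hsq, ← hN2] at hjac hone
  generalize √((x + y) ^ 2 + y ^ 2) = N at *
  generalize |x + y| = a at *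
  generalize |2 * (x + y) - x| = d at *
  generalize multiplier M x (x + y) = m at *
  generalize |x| = e at *
  have hM3 : 0 ≤ M ^ 3 * m := by positivity
  rcases le_or_gt W 0 with hW0 | hW0
  · nlinarith
  have hpow : a ≤ (1 + a) ^ 3 := by
    have : (1 + a) ^ 1 ≤ (1 + a) ^ 3 := pow_le_pow_right₀ (by linarith) (by norm_num)
    linarith
  have hWN : W ≤ 6 * N ^ 3 := by
    have h1 : W * (1 + a) ^ 3 ≤ 6 * N ^ 3 * (1 + a) ^ 3 := by
      refine hW'.trans ?_
      calc 6 * (a * N ^ 3) = 6 * N ^ 3 * a := by ring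
        _ ≤ _ := by gcongr
    exact le_of_mul_le_mul_right h1 (by positivity)
  rcases le_total (N ^ 2) (M ^ 2) with hQ | hQ
  · have h1 := hone hQ
    have h2 : N ≤ M := (abs_le_of_sq_le_sq' hQ (by linarith)).2
    have h3 : N ^ 3 ≤ M ^ 3 := by gcongr
    have h4 : M ^ 3 ≤ M ^ 3 * m := le_mul_of_one_le_right (by positivity) h1
    nlinarith
  have hj := hjac hQ
  have hN1 : 1 ≤ N := hM.trans (abs_le_of_sq_le_sq' hQ hN0).2
  rcases le_total (N / 2) d with h | h
  · have h2 : N ^ 3 ≤ 2 * (e * d * N ^ 2) := by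
      calc N ^ 3 = 2 * (1 * (N / 2) * N ^ 2) := by ring
        _ ≤ 2 * (e * d * N ^ 2) := by gcongr
    nlinarith
  · have heN : N ≤ e := by
      refine (abs_le_of_sq_le_sq' ?_ (by linarith)).2
      nlinarith
    have haN : N ≤ 4 * a := by linarith
    have hWN' : W ≤ 96 * N := by
      have h1 : W * (1 + a) ^ 3 ≤ 96 * N * (1 + a) ^ 3 := by
        refine hW'.trans ?_
        calc 6 * (a * N ^ 3) = 6 * (a * N * N ^ 2) := by ring
          _ ≤ 6 * (a * N * (4 * a) ^ 2) := by gcongr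
          _ = 96 * N * a ^ 3 := by ring
          _ ≤ _ := by gcongr; linarith
      exact le_of_mul_le_mul_right h1 (by positivity)
    by_cases hc : d * (1 + e) ≤ 1
    · have := hbr hc
      nlinarith
    · have h1 : 1 ≤ 2 * (e * d) := by nlinarith
      have h4 : N ^ 2 ≤ 2 * (e * d) * N ^ 2 := le_mul_of_one_le_left (by positivity) h1
      nlinarith

/-! ### Modulations and the pointwise kernel bound -/

theorem rpow_mul_rpow_le_swap {θ c x y : ℝ} (hθc : θ ≤ c) (hx : 1 ≤ x) (hxy : x ≤ y) :
    x ^ (-θ) * y ^ (-c) ≤ x ^ (-c) * y ^ (-θ) := by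
  have hx0 : 0 < x := by linarith
  have hy0 : 0 < y := by linarith
  calc x ^ (-θ) * y ^ (-c) = x ^ (-c) * x ^ (c - θ) * y ^ (-c) := by
        rw [← Real.rpow_add hx0]; congr 2; ring
    _ ≤ x ^ (-c) * y ^ (c - θ) * y ^ (-c) := by
        gcongr
    _ = x ^ (-c) * y ^ (-θ) := by
        rw [mul_assoc, ← Real.rpow_add hy0]; congr 2; ring

/-- The largest of three modulations controls the resonance, and takes the worse exponent. -/
theorem modulation_le {θ c h x y z : ℝ} (hθ0 : 0 ≤ θ) (hθ1 : θ ≤ 1) (hθc : θ ≤ c) (h0 : 0 ≤ h)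
    (hh : h ≤ |x| + |y| + |z|) :
    (1 + |x|) ^ (-θ) * ((1 + |y|) ^ (-c) * (1 + |z|) ^ (-c)) ≤
      3 * (1 + h) ^ (-θ) * ((1 + |y|) ^ (-c) * (1 + |z|) ^ (-c) +
        (1 + |x|) ^ (-c) * (1 + |z|) ^ (-c) + (1 + |x|) ^ (-c) * (1 + |y|) ^ (-c)) := by
  have hx : 1 ≤ 1 + |x| := by simp
  have hy : 1 ≤ 1 + |y| := by simp
  have hz : 1 ≤ 1 + |z| := by simp
  have hh' : 1 + h ≤ (1 + |x|) + (1 + |y|) + (1 + |z|) := by linarith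
  generalize 1 + |x| = X at *
  generalize 1 + |y| = Y at *
  generalize 1 + |z| = Z at *
  have key : ∀ T : ℝ, 1 ≤ T → 1 + h ≤ 3 * T → T ^ (-θ) ≤ 3 * (1 + h) ^ (-θ) := by
    intro T hT hhT
    calc T ^ (-θ) ≤ ((1 + h) / 3) ^ (-θ) :=
          Real.rpow_le_rpow_of_nonpos (by positivity) (by linarith) (by linarith)
      _ = 3 ^ θ * (1 + h) ^ (-θ) := by
          rw [Real.div_rpow (by positivity) (by norm_num), Real.rpow_neg (by norm_num : (0:ℝ) ≤ 3)]
          field_simp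
      _ ≤ 3 ^ (1 : ℝ) * (1 + h) ^ (-θ) := by gcongr; norm_num
      _ = _ := by rw [Real.rpow_one]
  have hX0 : 0 ≤ X ^ (-c) := by positivity
  have hY0 : 0 ≤ Y ^ (-c) := by positivity
  have hZ0 : 0 ≤ Z ^ (-c) := by positivity
  have hH0 : 0 ≤ 3 * (1 + h) ^ (-θ) := by positivity
  have h1 : 0 ≤ 3 * (1 + h) ^ (-θ) * (Y ^ (-c) * Z ^ (-c)) := by positivity
  have h2 : 0 ≤ 3 * (1 + h) ^ (-θ) * (X ^ (-c) * Z ^ (-c)) := by positivity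
  have h3 : 0 ≤ 3 * (1 + h) ^ (-θ) * (X ^ (-c) * Y ^ (-c)) := by positivity
  rw [mul_add, mul_add]
  by_cases hmx : Y ≤ X ∧ Z ≤ X
  · have := mul_le_mul_of_nonneg_right (key X hx (by linarith [hmx.1, hmx.2]))
      (mul_nonneg hY0 hZ0)
    linarith
  · rcases le_total Y Z with hYZ | hYZ
    · have hXZ : X ≤ Z := by
        by_contra! hcon
        exact hmx ⟨by linarith, hcon.le⟩
      -- An input modulation is largest: exchanging exponents gives it the weak exponent θ, to be
      -- spent on the resonance, and gives the output modulation the integrable exponent c.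
      have e1 := mul_le_mul_of_nonneg_right (rpow_mul_rpow_le_swap hθc hx hXZ) hY0
      have e2 := mul_le_mul_of_nonneg_right (key Z hz (by linarith)) (mul_nonneg hX0 hY0)
      nlinarith
    · have hXY : X ≤ Y := by
        by_contra! hcon
        exact hmx ⟨hcon.le, by linarith⟩
      have e1 := mul_le_mul_of_nonneg_right (rpow_mul_rpow_le_swap hθc hx hXY) hZ0
      have e2 := mul_le_mul_of_nonneg_right (key Y hy (by linarith)) (mul_nonneg hX0 hZ0)
      nlinarith

/-- Bounded or low input frequencies need no gain and go entirely into the first term. Otherwise the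
resonance gain is inserted and the resulting weight is compared with each of the three multipliers.
-/
theorem exists_freqWeight_mul_modulation_le {α β θ : ℝ} (hβ : β ≠ 0) (hθ : 5 / 6 ≤ θ)
    (hθ1 : θ < 1) :
    ∃ M C : ℝ, 0 < M ∧ 3 * |α| ≤ 4 * |β| * M ^ 2 ∧ 0 ≤ C ∧ ∀ x y s₀ s₁ s₂ : ℝ,
      |resonance α β x y| ≤ |s₀| + |s₁| + |s₂| →
      freqWeight θ x y * ((1 + |s₀|) ^ (-θ) * ((1 + |s₁|) ^ (-(2 - θ)) * (1 + |s₂|) ^ (-(2 - θ)))) ≤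
        C * (multiplier M (x + y) x * ((1 + |s₁|) ^ (-(2 - θ)) * (1 + |s₂|) ^ (-(2 - θ))) +
          multiplier M x (x + y) * ((1 + |s₀|) ^ (-(2 - θ)) * (1 + |s₂|) ^ (-(2 - θ))) +
          multiplier M y (x + y) * ((1 + |s₀|) ^ (-(2 - θ)) * (1 + |s₁|) ^ (-(2 - θ)))) := by
  have hβ' : 0 < |β| := abs_pos.2 hβ
  obtain ⟨M, hM4, hM⟩ : ∃ M : ℝ, 4 ≤ M ∧ 3 * |α| ≤ 2 * |β| * M ^ 2 := by
    -- The 4 serves `sq_le_multiplier_of_low`; the quotient r beats the cubic term through (4 + r)²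
    -- ≥ 8r.
    refine ⟨4 + |α| / |β|, ?_, ?_⟩
    · have : 0 ≤ |α| / |β| := by positivity
      linarith
    · have h1 : |β| * (|α| / |β|) = |α| := by field_simp
      have h2 : 0 ≤ |α| / |β| := by positivity
      have h3 : 8 * (|α| / |β|) ≤ (4 + |α| / |β|) ^ 2 := by nlinarith
      nlinarith [abs_nonneg α]
  have hM1 : 1 ≤ M := by linarith
  set ρ := 3 / 2 + 2 * θ with hρ
  set C₁ := 2 * M ^ 2 * ((1 + M) ^ ρ * (1 + M) ^ ρ) with hC₁
  set C₂ := (4 : ℝ) ^ ρ with hC₂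
  set K := (4 : ℝ) ^ ρ * (|β| / 2) ^ (-θ) with hK
  set L := 192 + 6 * M ^ 3 with hL
  have hC₁0 : 0 ≤ C₁ := by positivity
  have hC₂0 : 0 ≤ C₂ := by positivity
  have hK0 : 0 < K := by positivity
  have hL0 : 0 ≤ L := by positivity
  refine ⟨M, C₁ + C₂ + 3 * (K * L), by linarith, by nlinarith [abs_nonneg α], by positivity,
    fun x y s₀ s₁ s₂ hs => ?_⟩
  have hmod := modulation_le (c := 2 - θ) (by linarith) hθ1.le (by linarith)
    (abs_nonneg (resonance α β x y)) hs
  have h0 : (1 + |s₀|) ^ (-θ) ≤ 1 :=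
    Real.rpow_le_one_of_one_le_of_nonpos (by simp) (by linarith)
  have hf0 := freqWeight_nonneg θ x y
  have hA0 := multiplier_nonneg M (x + y) x
  have hB0 := multiplier_nonneg M x (x + y)
  have hD0 := multiplier_nonneg M y (x + y)
  have hd0 : 0 ≤ (1 + |s₀|) ^ (-(2 - θ)) := by positivity
  have hd1 : 0 ≤ (1 + |s₁|) ^ (-(2 - θ)) := by positivity
  have hd2 : 0 ≤ (1 + |s₂|) ^ (-(2 - θ)) := by positivity
  have hsq : sqSum (x + y) x = x ^ 2 + y ^ 2 := by simp only [sqSum]; ring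
  have hrefl : multiplier M (x + y) y = multiplier M (x + y) x := by
    rw [← multiplier_reflect M (x + y) x, add_sub_cancel_left]
  have hres0 : 0 ≤ (1 + |resonance α β x y|) ^ (-θ) := by positivity
  have hsmall : ∀ c : ℝ, c ≤ C₁ + C₂ + 3 * (K * L) →
      freqWeight θ x y ≤ c * multiplier M (x + y) x → freqWeight θ x y *
        ((1 + |s₀|) ^ (-θ) * ((1 + |s₁|) ^ (-(2 - θ)) * (1 + |s₂|) ^ (-(2 - θ)))) ≤
      (C₁ + C₂ + 3 * (K * L)) * (multiplier M (x + y) x *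
          ((1 + |s₁|) ^ (-(2 - θ)) * (1 + |s₂|) ^ (-(2 - θ))) +
          multiplier M x (x + y) * ((1 + |s₀|) ^ (-(2 - θ)) * (1 + |s₂|) ^ (-(2 - θ))) +
          multiplier M y (x + y) * ((1 + |s₀|) ^ (-(2 - θ)) * (1 + |s₁|) ^ (-(2 - θ)))) := by
    intro c hc hle
    have hc0 := hf0.trans hle
    calc _ ≤ (c * multiplier M (x + y) x) *
          (1 * ((1 + |s₁|) ^ (-(2 - θ)) * (1 + |s₂|) ^ (-(2 - θ)))) := by gcongr
      _ ≤ ((C₁ + C₂ + 3 * (K * L)) * multiplier M (x + y) x) *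
          (1 * ((1 + |s₁|) ^ (-(2 - θ)) * (1 + |s₂|) ^ (-(2 - θ)))) := by gcongr
      _ = (C₁ + C₂ + 3 * (K * L)) * (multiplier M (x + y) x *
          ((1 + |s₁|) ^ (-(2 - θ)) * (1 + |s₂|) ^ (-(2 - θ)))) := by ring
      _ ≤ _ := by
        gcongr
        rw [add_assoc]
        exact le_add_of_nonneg_right (by positivity)
  have hKL : 0 ≤ 3 * (K * L) := by positivity
  rcases le_total (x ^ 2 + y ^ 2) (M ^ 2) with hQ | hQ
  · refine hsmall C₁ (by linarith) ?_
    exact (freqWeight_le_of_bounded (by linarith) (by linarith) hQ).trans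
      (le_mul_of_one_le_right hC₁0 (one_le_multiplier (by rw [hsq]; exact hQ)))
  -- The resonance contains the factor xy and may vanish here, so none of it is used.
  rcases le_total |x| 1 with hx | hx
  · refine hsmall C₂ (by linarith) ((freqWeight_le_of_low (by linarith) hx).trans ?_)
    gcongr
    exact sq_le_multiplier_of_low hM4 hx hQ
  rcases le_total |y| 1 with hy | hy
  · refine hsmall C₂ (by linarith) ?_
    rw [freqWeight_comm]
    refine (freqWeight_le_of_low (by linarith) hy).trans ?_
    gcongr
    have := sq_le_multiplier_of_low hM4 hy (by rw [add_comm]; exact hQ)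
    rw [add_comm y x] at this ⊢
    rwa [hrefl] at this
  set W := freqWeight θ x y * (1 + |resonance α β x y|) ^ (-θ) with hW
  have hkey : W * (1 + |x + y|) ^ 3 ≤ K * (|x + y| * √(x ^ 2 + y ^ 2) ^ 3) :=
    freqWeight_mul_resonance_le hβ hθ hθ1 hM1 hM hx hy hQ
  have hW1 : W / K * (1 + |x + y|) ^ 3 ≤ |x + y| * √(x ^ 2 + y ^ 2) ^ 3 := by
    rw [div_mul_eq_mul_div, div_le_iff₀ hK0]; linarith
  have hWA : W ≤ K * L * multiplier M (x + y) x := by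
    have h := le_multiplier_output hM1 hQ hW1
    rw [div_le_iff₀ hK0] at h
    have : 4 * multiplier M (x + y) x ≤ L * multiplier M (x + y) x := by
      gcongr
      have : 0 ≤ 6 * M ^ 3 := by positivity
      linarith
    calc W ≤ 4 * multiplier M (x + y) x * K := h
      _ ≤ L * multiplier M (x + y) x * K := by gcongr
      _ = _ := by ring
  have hWB : W ≤ K * L * multiplier M x (x + y) := by
    have h := le_multiplier_input hM1 hx hW1
    rw [div_le_iff₀ hK0] at h
    linarith
  have hWD : W ≤ K * L * multiplier M y (x + y) := by
    have h := le_multiplier_input (x := y) (y := x) (W := W / K) hM1 hy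
      (by rw [add_comm y x, add_comm (y ^ 2)]; exact hW1)
    rw [div_le_iff₀ hK0, add_comm y x] at h
    linarith
  have hC : 3 * (K * L) ≤ C₁ + C₂ + 3 * (K * L) := by linarith
  calc freqWeight θ x y *
        ((1 + |s₀|) ^ (-θ) * ((1 + |s₁|) ^ (-(2 - θ)) * (1 + |s₂|) ^ (-(2 - θ))))
      ≤ freqWeight θ x y * (3 * (1 + |resonance α β x y|) ^ (-θ) *
        ((1 + |s₁|) ^ (-(2 - θ)) * (1 + |s₂|) ^ (-(2 - θ)) +
          (1 + |s₀|) ^ (-(2 - θ)) * (1 + |s₂|) ^ (-(2 - θ)) +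
          (1 + |s₀|) ^ (-(2 - θ)) * (1 + |s₁|) ^ (-(2 - θ)))) := by gcongr
    _ = 3 * (W * ((1 + |s₁|) ^ (-(2 - θ)) * (1 + |s₂|) ^ (-(2 - θ))) +
        W * ((1 + |s₀|) ^ (-(2 - θ)) * (1 + |s₂|) ^ (-(2 - θ))) +
        W * ((1 + |s₀|) ^ (-(2 - θ)) * (1 + |s₁|) ^ (-(2 - θ)))) := by rw [hW]; ring
    _ ≤ 3 * (K * L * multiplier M (x + y) x *
          ((1 + |s₁|) ^ (-(2 - θ)) * (1 + |s₂|) ^ (-(2 - θ))) +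
        K * L * multiplier M x (x + y) * ((1 + |s₀|) ^ (-(2 - θ)) * (1 + |s₂|) ^ (-(2 - θ))) +
        K * L * multiplier M y (x + y) *
          ((1 + |s₀|) ^ (-(2 - θ)) * (1 + |s₁|) ^ (-(2 - θ)))) := by gcongr
    _ = 3 * (K * L) * (multiplier M (x + y) x *
          ((1 + |s₁|) ^ (-(2 - θ)) * (1 + |s₂|) ^ (-(2 - θ))) +
        multiplier M x (x + y) * ((1 + |s₀|) ^ (-(2 - θ)) * (1 + |s₂|) ^ (-(2 - θ))) +
        multiplier M y (x + y) * ((1 + |s₀|) ^ (-(2 - θ)) * (1 + |s₁|) ^ (-(2 - θ)))) := by ring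
    _ ≤ _ := by gcongr

theorem weight_pos (α β s b : ℝ) (ζ : ℝ × ℝ) : 0 < weight α β s b ζ := by
  unfold weight; positivity

/-- Since 2s + ρ ≥ 0, the inequality ⟨x + y⟩ ≤ ⟨x⟩⟨y⟩ raised to this power reduces every admissible
s to the extreme case 2s = -ρ. -/
theorem sobolevWeight_le_freqWeight {θ s : ℝ} (hs : -(2 * s) ≤ 3 / 2 + 2 * θ) (x y : ℝ) :
    (x + y) ^ 2 * (1 + |x + y|) ^ (2 * s) * (((1 + |x|) ^ (2 * s))⁻¹ * ((1 + |y|) ^ (2 * s))⁻¹) ≤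
      freqWeight θ x y := by
  set ρ := 3 / 2 + 2 * θ
  have h1 : 1 + |x + y| ≤ (1 + |x|) * (1 + |y|) := by
    have := abs_add_le x y
    nlinarith [abs_nonneg x, abs_nonneg y]
  have hsplit : ∀ z : ℝ, (1 + |z|) ^ ρ = (1 + |z|) ^ (2 * s + ρ) * ((1 + |z|) ^ (2 * s))⁻¹ := by
    intro z
    rw [← Real.rpow_neg (by positivity), ← Real.rpow_add (by positivity)]
    congr 1; ring
  have h2 : (1 + |x + y|) ^ (2 * s) = (1 + |x + y|) ^ (2 * s + ρ) * (1 + |x + y|) ^ (-ρ) := by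
    rw [← Real.rpow_add (by positivity)]; congr 1; ring
  have h3 : (1 + |x + y|) ^ (2 * s + ρ) ≤ (1 + |x|) ^ (2 * s + ρ) * (1 + |y|) ^ (2 * s + ρ) := by
    rw [← Real.mul_rpow (by positivity) (by positivity)]
    exact Real.rpow_le_rpow (by positivity) h1 (by linarith)
  unfold freqWeight
  rw [hsplit x, hsplit y, h2]
  calc _ ≤ (x + y) ^ 2 * ((1 + |x|) ^ (2 * s + ρ) * (1 + |y|) ^ (2 * s + ρ) *
        (1 + |x + y|) ^ (-ρ)) * (((1 + |x|) ^ (2 * s))⁻¹ * ((1 + |y|) ^ (2 * s))⁻¹) := by gcongr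
    _ = _ := by ring

/-- The square of the kernel of the bilinear form is dominated by three kernels, each
integrable uniformly in its first argument. -/
theorem exists_weight_le_kernel {α β θ s : ℝ} (hβ : β ≠ 0) (hθ : 5 / 6 ≤ θ) (hθ1 : θ < 1)
    (hs : -(2 * s) ≤ 3 / 2 + 2 * θ) :
    ∃ M C : ℝ, 0 < M ∧ 3 * |α| ≤ 4 * |β| * M ^ 2 ∧ ∀ ζ ζ₁ : ℝ × ℝ,
      ENNReal.ofReal (ζ.1 ^ 2 * weight α β s (-θ / 2) ζ *
          ((weight α β s ((2 - θ) / 2) ζ₁)⁻¹ * (weight α β s ((2 - θ) / 2) (ζ - ζ₁))⁻¹)) ≤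
        ENNReal.ofReal C * (kernel α β M (2 - θ) ζ ζ₁ + kernel α β M (2 - θ) ζ₁ ζ +
          kernel α β M (2 - θ) (ζ - ζ₁) ζ) := by
  obtain ⟨M, C, hM0, hM, hC, h⟩ := exists_freqWeight_mul_modulation_le (α := α) hβ hθ hθ1
  refine ⟨M, C, hM0, hM, fun ζ ζ₁ => ?_⟩
  obtain ⟨x, t⟩ := ζ₁
  obtain ⟨y, r, rfl⟩ : ∃ y r, ζ = (x + y, t + r) := ⟨ζ.1 - x, ζ.2 - t, by simp⟩
  have hres : |resonance α β x y| ≤ |t + r - phase α β (x + y)| + |t - phase α β x| +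
      |r - phase α β y| := by
    have e : resonance α β x y = (t + r - phase α β (x + y)) - (t - phase α β x) -
        (r - phase α β y) := by simp only [resonance]; ring
    rw [e]
    exact (abs_sub _ _).trans (add_le_add_left (abs_sub _ _) _)
  have h1 := h x y _ _ _ hres
  have hfw := sobolevWeight_le_freqWeight hs x y
  have e0 : (x + y, t + r) - (x, t) = (y, r) := by simp
  have e1 : t + r - t - phase α β (x + y - x) = r - phase α β y := by simp
  -- As p is odd, fixing an input only changes the sign of the other input's modulation, which the
  -- even function `decay` does not see.
  have e2 : t - (t + r) - phase α β (x - (x + y)) = -(r - phase α β y) := by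
    simp only [phase]; ring
  have e3 : r - (t + r) - phase α β (y - (x + y)) = -(t - phase α β x) := by
    simp only [phase]; ring
  simp only [kernel, e0, e1, e2, e3, decay_neg]
  simp only [decay]
  have hA0 := multiplier_nonneg M (x + y) x
  have hB0 := multiplier_nonneg M x (x + y)
  have hD0 := multiplier_nonneg M y (x + y)
  rw [← ENNReal.ofReal_mul (by positivity), ← ENNReal.ofReal_mul (by positivity),
    ← ENNReal.ofReal_mul (by positivity), ← ENNReal.ofReal_mul (by positivity),
    ← ENNReal.ofReal_mul (by positivity), ← ENNReal.ofReal_mul (by positivity),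
    ← ENNReal.ofReal_add (by positivity) (by positivity),
    ← ENNReal.ofReal_add (by positivity) (by positivity), ← ENNReal.ofReal_mul (by positivity)]
  refine ENNReal.ofReal_le_ofReal (le_trans ?_ h1)
  have ec : 2 * ((2 - θ) / 2) = 2 - θ := by ring
  have eθ : 2 * (-θ / 2) = -θ := by ring
  simp only [weight, ec, eθ, mul_inv]
  rw [Real.rpow_neg (by positivity : 0 ≤ 1 + |t - phase α β x|),
    Real.rpow_neg (by positivity : 0 ≤ 1 + |r - phase α β y|)]
  calc _ = ((x + y) ^ 2 * (1 + |x + y|) ^ (2 * s) *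
        (((1 + |x|) ^ (2 * s))⁻¹ * ((1 + |y|) ^ (2 * s))⁻¹)) *
        ((1 + |t + r - phase α β (x + y)|) ^ (-θ) *
          (((1 + |t - phase α β x|) ^ (2 - θ))⁻¹ * ((1 + |r - phase α β y|) ^ (2 - θ))⁻¹)) := by
        ring
    _ ≤ _ := by gcongr

/-! ### Bilinear L² bounds from Cauchy–Schwarz -/

theorem sq_lintegral_mul_le {E : Type*} [MeasurableSpace E] {μ : Measure E} {f g : E → ℝ≥0∞}
    (hf : AEMeasurable f μ) (hg : AEMeasurable g μ) :
    (∫⁻ x, f x * g x ∂μ) ^ 2 ≤ (∫⁻ x, f x ^ 2 ∂μ) * ∫⁻ x, g x ^ 2 ∂μ := by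
  have h := ENNReal.lintegral_mul_le_Lp_mul_Lq μ Real.HolderConjugate.two_two hf hg
  have hroot : ∀ y : ℝ≥0∞, (y ^ (1 / 2 : ℝ)) ^ 2 = y := fun y => by
    rw [← ENNReal.rpow_natCast, ← ENNReal.rpow_mul]; norm_num
  calc (∫⁻ x, f x * g x ∂μ) ^ 2 ≤ _ := pow_le_pow_left₀ zero_le h 2
    _ = _ := by
      rw [mul_pow, hroot, hroot]
      simp only [ENNReal.rpow_ofNat]

section Bilinear

variable {E : Type*} [AddCommGroup E] [MeasurableSpace E] [MeasurableAdd₂ E] [MeasurableNeg E]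
  {μ : Measure E} [SFinite μ] [μ.IsAddLeftInvariant]
  {f g : E → ℝ≥0∞} {K : E → E → ℝ≥0∞} {C : ℝ≥0∞}

/-- Cauchy–Schwarz for a kernel that is square integrable in the input variable. -/
theorem lintegral_sq_bilinear_le_of_output (hf : Measurable f) (hg : Measurable g)
    (hK : Measurable fun q : E × E => K q.1 q.2) (hC : ∀ w, ∫⁻ z, K w z ^ 2 ∂μ ≤ C) :
    ∫⁻ w, (∫⁻ z, K w z * (f z * g (w - z)) ∂μ) ^ 2 ∂μ ≤
      C * ((∫⁻ z, f z ^ 2 ∂μ) * ∫⁻ z, g z ^ 2 ∂μ) := by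
  have hm : Measurable fun q : E × E => (f q.2 * g (q.1 - q.2)) ^ 2 := by fun_prop
  calc ∫⁻ w, (∫⁻ z, K w z * (f z * g (w - z)) ∂μ) ^ 2 ∂μ
      ≤ ∫⁻ w, C * ∫⁻ z, (f z * g (w - z)) ^ 2 ∂μ ∂μ := by
        refine lintegral_mono fun w => (sq_lintegral_mul_le ?_ ?_).trans ?_
        · exact (hK.comp measurable_prodMk_left).aemeasurable
        · fun_prop
        · gcongr
          exact hC w
    _ = C * ∫⁻ w, ∫⁻ z, (f z * g (w - z)) ^ 2 ∂μ ∂μ :=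
        lintegral_const_mul _ hm.lintegral_prod_right'
    _ = C * ∫⁻ z, ∫⁻ w, (f z * g (w - z)) ^ 2 ∂μ ∂μ := by
        rw [lintegral_lintegral_swap hm.aemeasurable]
    _ = C * ∫⁻ z, f z ^ 2 * ∫⁻ w, g w ^ 2 ∂μ ∂μ := by
        congr 1
        refine lintegral_congr fun z => ?_
        simp only [mul_pow]
        rw [lintegral_const_mul _ (by fun_prop), lintegral_sub_right_eq_self (fun w => g w ^ 2)]
    _ = _ := by rw [lintegral_mul_const _ (by fun_prop)]

/-- Cauchy–Schwarz for a kernel that is square integrable in the output variable. -/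
theorem lintegral_sq_bilinear_le_of_input [μ.IsNegInvariant] (hf : Measurable f) (hg : Measurable g)
    (hK : Measurable fun q : E × E => K q.1 q.2) (hC : ∀ w, ∫⁻ z, K w z ^ 2 ∂μ ≤ C) :
    ∫⁻ w, (∫⁻ z, K z w * (f z * g (w - z)) ∂μ) ^ 2 ∂μ ≤
      C * ((∫⁻ z, f z ^ 2 ∂μ) * ∫⁻ z, g z ^ 2 ∂μ) := by
  have hK' : Measurable fun q : E × E => K q.2 q.1 := hK.comp measurable_swap
  have hm : Measurable fun q : E × E => (K q.2 q.1 * f q.2) ^ 2 := by fun_prop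
  calc ∫⁻ w, (∫⁻ z, K z w * (f z * g (w - z)) ∂μ) ^ 2 ∂μ
      ≤ ∫⁻ w, (∫⁻ z, (K z w * f z) ^ 2 ∂μ) * ∫⁻ z, g z ^ 2 ∂μ ∂μ := by
        refine lintegral_mono fun w => ?_
        -- The kernel is grouped with f, so that the other factor is the L² norm of g, independent
        -- of w.
        simp only [← mul_assoc]
        refine (sq_lintegral_mul_le ?_ (by fun_prop)).trans ?_
        · have : Measurable fun z => K z w :=
            Measurable.comp (g := fun q : E × E => K q.1 q.2) hK measurable_prodMk_right
          fun_prop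
        · rw [lintegral_sub_left_eq_self (fun z => g z ^ 2)]
    _ = (∫⁻ w, ∫⁻ z, (K z w * f z) ^ 2 ∂μ ∂μ) * ∫⁻ z, g z ^ 2 ∂μ :=
        lintegral_mul_const _ hm.lintegral_prod_right'
    _ = (∫⁻ z, ∫⁻ w, (K z w * f z) ^ 2 ∂μ ∂μ) * ∫⁻ z, g z ^ 2 ∂μ := by
        rw [lintegral_lintegral_swap hm.aemeasurable]
    _ ≤ (∫⁻ z, C * f z ^ 2 ∂μ) * ∫⁻ z, g z ^ 2 ∂μ := by
        gcongr with z
        simp only [mul_pow]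
        rw [lintegral_mul_const]
        · gcongr
          exact hC z
        · exact (hK.comp measurable_prodMk_left).pow_const 2
    _ = _ := by rw [lintegral_const_mul _ (by fun_prop), mul_assoc]

theorem sq_add_add_le (a b c : ℝ≥0∞) : (a + b + c) ^ 2 ≤ 3 * (a ^ 2 + b ^ 2 + c ^ 2) := by
  have h := ENNReal.inner_le_Lp_mul_Lq (s := Finset.univ) (f := ![a, b, c]) (g := fun _ : Fin 3 => 1)
    Real.HolderConjugate.two_two
  simp only [Fin.sum_univ_three, Matrix.cons_val_zero, Matrix.cons_val_one, Matrix.cons_val, mul_one,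
    ENNReal.rpow_ofNat] at h
  have hroot : ∀ y : ℝ≥0∞, (y ^ (1 / 2 : ℝ)) ^ 2 = y := fun y => by
    rw [← ENNReal.rpow_natCast, ← ENNReal.rpow_mul]; norm_num
  calc (a + b + c) ^ 2 ≤ _ := pow_le_pow_left₀ zero_le h 2
    _ = _ := by
      rw [mul_pow, hroot, hroot]
      norm_num
      ring

/-- The `L²` bound for a bilinear form whose squared kernel is dominated by three kernels, one
for each frequency variable to be held fixed. -/
theorem lintegral_sq_bilinear_le [μ.IsNegInvariant] {k : E → E → ℝ≥0∞} {G : E → E → ℝ≥0∞} {A : ℝ≥0∞}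
    (hf : Measurable f) (hg : Measurable g) (hG : Measurable fun q : E × E => G q.1 q.2)
    (hC : ∀ w, ∫⁻ z, G w z ∂μ ≤ C)
    (hk : ∀ w z, k w z ^ 2 ≤ A * (G w z + G z w + G (w - z) w)) :
    ∫⁻ w, (∫⁻ z, k w z * (f z * g (w - z)) ∂μ) ^ 2 ∂μ ≤
      9 * A * C * ((∫⁻ z, f z ^ 2 ∂μ) * ∫⁻ z, g z ^ 2 ∂μ) := by
  set K : E → E → ℝ≥0∞ := fun w z => G w z ^ (1 / 2 : ℝ) with hKdef
  have hsq : ∀ w z, K w z ^ 2 = G w z := fun w z => by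
    rw [hKdef, ← ENNReal.rpow_natCast, ← ENNReal.rpow_mul]; norm_num
  have hK : Measurable fun q : E × E => K q.1 q.2 := hG.pow_const _
  have hK2 : Measurable fun q : E × E => K q.2 q.1 := hK.comp measurable_swap
  have hK3 : Measurable fun q : E × E => K (q.1 - q.2) q.1 :=
    Measurable.comp (g := fun q : E × E => K q.1 q.2) (f := fun q : E × E => (q.1 - q.2, q.1))
      hK (by fun_prop)
  have hC' : ∀ w, ∫⁻ z, K w z ^ 2 ∂μ ≤ C := fun w => by simpa only [hsq] using hC w
  have hkK : ∀ w z, k w z ≤ A ^ (1 / 2 : ℝ) * (K w z + K z w + K (w - z) w) := by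
    intro w z
    refine (ENNReal.pow_le_pow_left_iff two_ne_zero).1 ((hk w z).trans ?_)
    rw [mul_pow, ← ENNReal.rpow_natCast (A ^ (1 / 2 : ℝ)), ← ENNReal.rpow_mul]
    norm_num only [ENNReal.rpow_one]
    gcongr
    rw [← hsq w z, ← hsq z w, ← hsq (w - z) w]
    calc K w z ^ 2 + K z w ^ 2 + K (w - z) w ^ 2
        ≤ K w z ^ 2 + K z w ^ 2 + K (w - z) w ^ 2 +
          2 * (K w z * K z w + K w z * K (w - z) w + K z w * K (w - z) w) := le_self_add
      _ = _ := by ring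
  set I₁ : E → ℝ≥0∞ := fun w => ∫⁻ z, K w z * (f z * g (w - z)) ∂μ with hI₁
  set I₂ : E → ℝ≥0∞ := fun w => ∫⁻ z, K z w * (f z * g (w - z)) ∂μ with hI₂
  set I₃ : E → ℝ≥0∞ := fun w => ∫⁻ z, K (w - z) w * (f z * g (w - z)) ∂μ with hI₃
  have hm₁ : Measurable fun q : E × E => K q.1 q.2 * (f q.2 * g (q.1 - q.2)) := by fun_prop
  have hm₂ : Measurable fun q : E × E => K q.2 q.1 * (f q.2 * g (q.1 - q.2)) := by fun_prop
  have hm₃ : Measurable fun q : E × E => K (q.1 - q.2) q.1 * (f q.2 * g (q.1 - q.2)) := by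
    fun_prop
  have hpt : ∀ w, (∫⁻ z, k w z * (f z * g (w - z)) ∂μ) ^ 2 ≤
      3 * A * (I₁ w ^ 2 + I₂ w ^ 2 + I₃ w ^ 2) := by
    intro w
    have h1 : ∫⁻ z, k w z * (f z * g (w - z)) ∂μ ≤ A ^ (1 / 2 : ℝ) * (I₁ w + I₂ w + I₃ w) := by
      calc ∫⁻ z, k w z * (f z * g (w - z)) ∂μ
          ≤ ∫⁻ z, A ^ (1 / 2 : ℝ) * (K w z * (f z * g (w - z)) + K z w * (f z * g (w - z)) +
              K (w - z) w * (f z * g (w - z))) ∂μ := by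
            refine lintegral_mono fun z => ?_
            calc _ ≤ A ^ (1 / 2 : ℝ) * (K w z + K z w + K (w - z) w) * (f z * g (w - z)) := by
                  gcongr; exact hkK w z
              _ = _ := by ring
        _ = _ := by
            have s₁ : Measurable fun z => K w z * (f z * g (w - z)) :=
              hm₁.comp measurable_prodMk_left
            have s₂ : Measurable fun z => K z w * (f z * g (w - z)) :=
              hm₂.comp measurable_prodMk_left
            have s₃ : Measurable fun z => K (w - z) w * (f z * g (w - z)) :=
              hm₃.comp measurable_prodMk_left
            have s₁₂ : Measurable fun z => K w z * (f z * g (w - z)) +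
              K z w * (f z * g (w - z)) := s₁.add s₂
            rw [lintegral_const_mul _ (by exact s₁₂.add s₃), lintegral_add_left s₁₂,
              lintegral_add_left s₁]
    calc _ ≤ (A ^ (1 / 2 : ℝ) * (I₁ w + I₂ w + I₃ w)) ^ 2 := pow_le_pow_left₀ zero_le h1 2
      _ = A * (I₁ w + I₂ w + I₃ w) ^ 2 := by
          rw [mul_pow, ← ENNReal.rpow_natCast (A ^ (1 / 2 : ℝ)), ← ENNReal.rpow_mul]
          norm_num
      _ ≤ A * (3 * (I₁ w ^ 2 + I₂ w ^ 2 + I₃ w ^ 2)) := by gcongr; exact sq_add_add_le _ _ _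
      _ = _ := by ring
  have hJ₁ : Measurable fun w => I₁ w ^ 2 := hm₁.lintegral_prod_right'.pow_const 2
  have hJ₂ : Measurable fun w => I₂ w ^ 2 := hm₂.lintegral_prod_right'.pow_const 2
  have hJ₃ : Measurable fun w => I₃ w ^ 2 := hm₃.lintegral_prod_right'.pow_const 2
  have b₁ := lintegral_sq_bilinear_le_of_output hf hg hK hC'
  have b₂ := lintegral_sq_bilinear_le_of_input hf hg hK hC'
  have b₃ := lintegral_sq_bilinear_le_of_input hg hf hK hC'
  -- The reflection z ↦ w - z exchanges the inputs and reduces the third kernel to the second.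
  have e₃ : ∀ w, ∫⁻ z, K z w * (g z * f (w - z)) ∂μ = I₃ w := by
    intro w
    rw [hI₃, ← lintegral_sub_left_eq_self _ w]
    refine lintegral_congr fun z => ?_
    rw [sub_sub_cancel, mul_comm (g _)]
  simp only [e₃] at b₃
  calc _ ≤ ∫⁻ w, 3 * A * (I₁ w ^ 2 + I₂ w ^ 2 + I₃ w ^ 2) ∂μ := lintegral_mono hpt
    _ = 3 * A * (∫⁻ w, I₁ w ^ 2 ∂μ + ∫⁻ w, I₂ w ^ 2 ∂μ + ∫⁻ w, I₃ w ^ 2 ∂μ) := by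
        have hJ₁₂ : Measurable fun w => I₁ w ^ 2 + I₂ w ^ 2 := hJ₁.add hJ₂
        rw [lintegral_const_mul _ (by exact hJ₁₂.add hJ₃), lintegral_add_left hJ₁₂,
          lintegral_add_left hJ₁]
    _ ≤ 3 * A * (C * ((∫⁻ z, f z ^ 2 ∂μ) * ∫⁻ z, g z ^ 2 ∂μ) +
          C * ((∫⁻ z, f z ^ 2 ∂μ) * ∫⁻ z, g z ^ 2 ∂μ) +
          C * ((∫⁻ z, g z ^ 2 ∂μ) * ∫⁻ z, f z ^ 2 ∂μ)) := by gcongr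
    _ = _ := by ring

end Bilinear

/-! ### Fourier inversion, products and derivatives -/

/-- The exponential `e^{i(xξ + tτ)}`. -/
noncomputable def planeWave (z ζ : ℝ × ℝ) : ℂ :=
  Complex.exp (Complex.I * ((z.1 * ζ.1 + z.2 * ζ.2 : ℝ) : ℂ))

theorem fourier_eq_integral_planeWave (u : ℝ × ℝ → ℂ) (ζ : ℝ × ℝ) :
    fourier u ζ = ∫ z, planeWave z (-ζ) * u z := by
  unfold fourier planeWave
  congr 1 with z
  congr 2
  simp only [Prod.fst_neg, Prod.snd_neg]
  push_cast
  ring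

theorem continuous_planeWave : Continuous fun q : (ℝ × ℝ) × (ℝ × ℝ) => planeWave q.1 q.2 := by
  unfold planeWave
  fun_prop

theorem norm_planeWave (z ζ : ℝ × ℝ) : ‖planeWave z ζ‖ = 1 := by
  unfold planeWave
  rw [mul_comm, Complex.norm_exp_ofReal_mul_I]

theorem planeWave_add (z ζ κ : ℝ × ℝ) :
    planeWave z (ζ + κ) = planeWave z ζ * planeWave z κ := by
  unfold planeWave
  rw [← Complex.exp_add]
  congr 1
  simp only [Prod.fst_add, Prod.snd_add]
  push_cast
  ring

theorem fourier_integrable (u : Test) : Integrable (fourier u) := by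
  obtain ⟨D, hD⟩ := fourier_decay u 2
  have hbase : Integrable (fun ζ : ℝ × ℝ => (1 + ζ.1 ^ 2)⁻¹ * (1 + ζ.2 ^ 2)⁻¹) :=
    integrable_inv_one_add_sq.mul_prod integrable_inv_one_add_sq
  refine (hbase.const_mul D).mono' (fourier_continuous u).aestronglyMeasurable
    (Filter.Eventually.of_forall fun ζ => ?_)
  rw [← mul_inv, ← div_eq_mul_inv, le_div_iff₀ (by positivity)]
  have hsq : (1 + ζ.1 ^ 2) * (1 + ζ.2 ^ 2) ≤ ((1 + |ζ.1|) * (1 + |ζ.2|)) ^ 2 := by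
    rw [mul_pow]
    gcongr
    · nlinarith [abs_nonneg ζ.1, sq_abs ζ.1]
    · nlinarith [abs_nonneg ζ.2, sq_abs ζ.2]
  calc ‖fourier u ζ‖ * ((1 + ζ.1 ^ 2) * (1 + ζ.2 ^ 2))
      ≤ ‖fourier u ζ‖ * ((1 + |ζ.1|) * (1 + |ζ.2|)) ^ 2 := by gcongr
    _ = ((1 + |ζ.1|) * (1 + |ζ.2|)) ^ 2 * ‖fourier u ζ‖ := mul_comm _ _
    _ ≤ D := hD ζ

/-- The inversion theorem is available for `𝓕` on inner product spaces, so the plane is given its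
Euclidean structure; the dilation by 2π accounts for the two normalisations. -/
theorem fourier_comp_ofLp (u : ℝ × ℝ → ℂ) (w : WithLp 2 (ℝ × ℝ)) :
    𝓕 (fun v : WithLp 2 (ℝ × ℝ) => u v.ofLp) w = fourier u ((2 * Real.pi) • w.ofLp) := by
  rw [Real.fourier_eq', fourier_eq_integral_planeWave,
    ← (WithLp.volume_preserving_ofLp ℝ ℝ).integral_comp
      (WithLp.homeomorphProd 2 ℝ ℝ).measurableEmbedding]
  congr 1 with v
  rw [smul_eq_mul]
  congr 1
  unfold planeWave
  congr 1
  simp [WithLp.prod_inner_apply]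
  ring

/-- Fourier inversion for test functions on the plane. -/
theorem fourier_inversion (u : Test) (z : ℝ × ℝ) :
    u z = (((2 * Real.pi) ^ 2)⁻¹ : ℝ) • ∫ ζ, planeWave z ζ * fourier u ζ := by
  set U : WithLp 2 (ℝ × ℝ) → ℂ := fun v => u v.ofLp with hU
  have hemb : MeasurableEmbedding (WithLp.ofLp : WithLp 2 (ℝ × ℝ) → ℝ × ℝ) :=
    (WithLp.homeomorphProd 2 ℝ ℝ).measurableEmbedding
  have hmp := WithLp.volume_preserving_ofLp ℝ ℝ
  have hc : Continuous U := u.continuous.comp (WithLp.homeomorphProd 2 ℝ ℝ).continuous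
  have hi : Integrable U := (hmp.integrable_comp_emb hemb).2 u.integrable
  have hπ : (2 * Real.pi) ≠ 0 := by positivity
  have hFU : 𝓕 U = fun w => fourier u ((2 * Real.pi) • w.ofLp) :=
    funext fun w => fourier_comp_ofLp u w
  have hFi : Integrable (𝓕 U) := by
    rw [hFU]
    exact (hmp.integrable_comp_emb hemb (g := fun ζ => fourier u ((2 * Real.pi) • ζ))).2
      ((fourier_integrable u).comp_smul hπ)
  have hinv := congrFun (hc.fourierInv_fourier_eq hi hFi) (WithLp.toLp 2 z)
  rw [Real.fourierInv_eq', hFU] at hinv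
  have hcomp := hmp.integral_comp hemb
    (fun ζ => planeWave z ((2 * Real.pi) • ζ) * fourier u ((2 * Real.pi) • ζ))
  rw [Measure.integral_comp_smul_of_nonneg volume (fun ζ => planeWave z ζ * fourier u ζ)
    (2 * Real.pi) (hR := by positivity)] at hcomp
  rw [show Module.finrank ℝ (ℝ × ℝ) = 2 by simp] at hcomp
  rw [← hcomp]
  have : u z = U (WithLp.toLp 2 z) := rfl
  rw [this, ← hinv]
  congr 1 with v
  rw [smul_eq_mul]
  congr 1
  unfold planeWave
  congr 1
  simp [WithLp.prod_inner_apply]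
  ring

/-- The Fourier transform takes products to convolutions. -/
theorem fourier_mul (u v : Test) (ζ : ℝ × ℝ) :
    fourier (u.mul v) ζ =
      (((2 * Real.pi) ^ 2)⁻¹ : ℝ) • ∫ κ, fourier u κ * fourier v (ζ - κ) := by
  have hmul : ∀ z, (u.mul v) z = u z * v z := fun _ => rfl
  have hint : Integrable (fun q : (ℝ × ℝ) × (ℝ × ℝ) =>
      planeWave q.1 (q.2 - ζ) * (v q.1 * fourier u q.2)) (volume.prod volume) := by
    refine (v.integrable.mul_prod (fourier_integrable u)).bdd_mul (c := 1) ?_ ?_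
    · exact (continuous_planeWave.comp (f := fun q : (ℝ × ℝ) × (ℝ × ℝ) => (q.1, q.2 - ζ))
        (by fun_prop)).aestronglyMeasurable
    · exact Filter.Eventually.of_forall fun q => (norm_planeWave _ _).le
  calc fourier (u.mul v) ζ
      = ∫ z, (((2 * Real.pi) ^ 2)⁻¹ : ℝ) • ∫ κ,
          planeWave z (κ - ζ) * (v z * fourier u κ) := by
        rw [fourier_eq_integral_planeWave]
        congr 1 with z
        rw [hmul, fourier_inversion u z, smul_mul_assoc, mul_smul_comm, ← integral_mul_const,
          ← integral_const_mul]
        congr 2 with κ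
        rw [sub_eq_add_neg, planeWave_add]
        ring
    _ = (((2 * Real.pi) ^ 2)⁻¹ : ℝ) • ∫ κ, ∫ z,
          planeWave z (κ - ζ) * (v z * fourier u κ) := by
        rw [integral_smul, integral_integral_swap hint]
    _ = _ := by
        congr 2 with κ
        rw [fourier_eq_integral_planeWave v, ← integral_const_mul]
        congr 1 with z
        rw [neg_sub]
        ring

theorem fourier_dx (u : Test) (ζ : ℝ × ℝ) :
    fourier u.dx ζ = Complex.I * ζ.1 * fourier u ζ := by
  have hcw : Continuous fun z => planeWave z (-ζ) := by
    unfold planeWave; fun_prop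
  have hi : ∀ w : Test, Integrable fun z => planeWave z (-ζ) * w z := fun w =>
    w.integrable.bdd_mul (c := 1) hcw.aestronglyMeasurable
      (Filter.Eventually.of_forall fun z => (norm_planeWave _ _).le)
  have hu : ∀ z, HasLineDerivAt ℝ (u : ℝ × ℝ → ℂ) (u.dx z) z (1, 0) := by
    intro z
    have h : u.dx z = lineDeriv ℝ u z (1, 0) :=
      TestFunction.lineDerivCLM_apply_of_le (𝕜 := ℝ) (n := ⊤) (k := ⊤) (f := u) (by simp)
    rw [h]
    exact ((u.contDiff.differentiable (by simp)) z).lineDifferentiableAt.hasLineDerivAt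
  have hw : ∀ z, HasLineDerivAt ℝ (fun z => planeWave z (-ζ))
      (-(Complex.I * ζ.1) * planeWave z (-ζ)) z (1, 0) := by
    intro z
    unfold HasLineDerivAt planeWave
    have h1 : HasDerivAt (fun t : ℝ => ((z + t • ((1, 0) : ℝ × ℝ)).1 * (-ζ).1 +
        (z + t • ((1, 0) : ℝ × ℝ)).2 * (-ζ).2 : ℝ)) (-ζ.1) 0 := by
      simpa using (((hasDerivAt_id (0 : ℝ)).const_add z.1).mul_const (-ζ.1)).add_const (-(z.2 * ζ.2))
    have h2 := (h1.ofReal_comp.const_mul Complex.I).cexp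
    refine h2.congr_deriv ?_
    simp
    ring
  have hparts := integral_bilinear_hasLineDerivAt_right_eq_neg_left_of_integrable
    (μ := (volume : Measure (ℝ × ℝ))) (B := ContinuousLinearMap.mul ℝ ℂ) (v := ((1, 0) : ℝ × ℝ))
    (f := fun z => planeWave z (-ζ)) (f' := fun z => -(Complex.I * ζ.1) * planeWave z (-ζ))
    (g := u) (g' := u.dx)
    (by simpa only [ContinuousLinearMap.mul_apply', mul_assoc] using
      (hi u).const_mul (-(Complex.I * ζ.1)))
    (hi u.dx) (hi u) (fun z _ => hw z) (fun z _ => hu z)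
  simp only [ContinuousLinearMap.mul_apply', mul_assoc] at hparts
  rw [fourier_eq_integral_planeWave, hparts, integral_const_mul, fourier_eq_integral_planeWave]
  ring

/-! ### The estimate for test functions -/

theorem enorm_fourier_dx_mul_le (u v : Test) (ζ : ℝ × ℝ) :
    ‖fourier (u.mul v).dx ζ‖ₑ ≤
      ENNReal.ofReal |ζ.1| * ∫⁻ κ, ‖fourier u κ‖ₑ * ‖fourier v (ζ - κ)‖ₑ := by
  have hπ : ‖(((2 * Real.pi) ^ 2)⁻¹ : ℝ)‖ₑ ≤ 1 := by
    rw [Real.enorm_of_nonneg (by positivity), ENNReal.ofReal_le_one]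
    refine inv_le_one_of_one_le₀ (one_le_pow₀ ?_)
    linarith [Real.pi_gt_three]
  have hξ : ‖Complex.I * (ζ.1 : ℂ)‖ₑ = ENNReal.ofReal |ζ.1| := by
    rw [← ofReal_norm]; simp
  rw [fourier_dx, enorm_mul, hξ, fourier_mul, enorm_smul]
  gcongr
  calc _ ≤ 1 * ∫⁻ κ, ‖fourier u κ * fourier v (ζ - κ)‖ₑ := by
        gcongr
        exact enorm_integral_le_lintegral_enorm _
    _ = _ := by simp only [one_mul, enorm_mul]

theorem measurable_enorm_fourier (u : Test) : Measurable fun ζ => ‖fourier u ζ‖ₑ :=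
  (fourier_continuous u).enorm.measurable

theorem ofReal_bourgainNorm_sq (α β s b : ℝ) (u : Test) :
    ENNReal.ofReal (bourgainNorm α β s b u) ^ 2 =
      ∫⁻ ζ, ENNReal.ofReal (weight α β s b ζ) * ‖fourier u ζ‖ₑ ^ 2 := by
  have h0 : 0 ≤ ∫ ζ : ℝ × ℝ, weight α β s b ζ * ‖fourier u ζ‖ ^ 2 :=
    integral_nonneg fun ζ => mul_nonneg (weight_nonneg α β s b ζ) (by positivity)
  rw [bourgainNorm, ← ENNReal.ofReal_pow (Real.sqrt_nonneg _), Real.sq_sqrt h0,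
    ofReal_integral_eq_lintegral_ofReal (integrable_weight_mul α β s b u)
      (Filter.Eventually.of_forall fun ζ => mul_nonneg (weight_nonneg α β s b ζ) (by positivity))]
  refine lintegral_congr fun ζ => ?_
  rw [ENNReal.ofReal_mul (weight_nonneg α β s b ζ), ENNReal.ofReal_pow (norm_nonneg _), ofReal_norm]

/-- Absorbing the square root of the weight into each transform makes the input norms plain L² norms
and puts all weights into one kernel, whose square was bounded pointwise. -/
theorem exists_bourgainNorm_dx_mul_le {α β θ s : ℝ} (hβ : β ≠ 0) (hθ : 5 / 6 ≤ θ) (hθ1 : θ < 1)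
    (hs : -(2 * s) ≤ 3 / 2 + 2 * θ) :
    ∃ c : ℝ, 0 < c ∧ ∀ u v : Test, bourgainNorm α β s (-θ / 2) (u.mul v).dx ≤
      c * bourgainNorm α β s ((2 - θ) / 2) u * bourgainNorm α β s ((2 - θ) / 2) v := by
  obtain ⟨M, A, hM0, hM, hk⟩ := exists_weight_le_kernel (α := α) hβ hθ hθ1 hs
  obtain ⟨C, hC, hG⟩ := exists_lintegral_kernel_le (c := 2 - θ) hβ hM0 hM (by linarith)
  set D : ℝ≥0∞ := 9 * ENNReal.ofReal A * C with hD
  have hDtop : D ≠ ⊤ := by finiteness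
  refine ⟨√D.toReal + 1, by positivity, fun u v => ?_⟩
  set w₁ : ℝ × ℝ → ℝ := weight α β s ((2 - θ) / 2) with hw₁
  set w₀ : ℝ × ℝ → ℝ := weight α β s (-θ / 2) with hw₀
  have hw₁0 : ∀ ζ, 0 < w₁ ζ := weight_pos α β s _
  have hw₀0 : ∀ ζ, 0 < w₀ ζ := weight_pos α β s _
  have hw₁c : Continuous w₁ := weight_continuous α β s _
  let F : Test → ℝ × ℝ → ℝ≥0∞ := fun u ζ => ENNReal.ofReal √(w₁ ζ) * ‖fourier u ζ‖ₑ
  have hF : ∀ u, Measurable (F u) := fun u =>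
    hw₁c.sqrt.measurable.ennreal_ofReal.mul (measurable_enorm_fourier u)
  have hF2 : ∀ u, ∫⁻ ζ, F u ζ ^ 2 = ENNReal.ofReal (bourgainNorm α β s ((2 - θ) / 2) u) ^ 2 := by
    intro u
    rw [ofReal_bourgainNorm_sq]
    refine lintegral_congr fun ζ => ?_
    rw [mul_pow, ← ENNReal.ofReal_pow (Real.sqrt_nonneg _), Real.sq_sqrt (hw₁0 ζ).le]
  have hinv : ∀ (u : Test) (ζ : ℝ × ℝ), ‖fourier u ζ‖ₑ = ENNReal.ofReal (√(w₁ ζ))⁻¹ * F u ζ := by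
    intro u ζ
    have hpos : 0 < √(w₁ ζ) := Real.sqrt_pos.2 (hw₁0 ζ)
    simp only [F]
    rw [← mul_assoc, ← ENNReal.ofReal_mul (by positivity), inv_mul_cancel₀ hpos.ne',
      ENNReal.ofReal_one, one_mul]
  let k : ℝ × ℝ → ℝ × ℝ → ℝ≥0∞ := fun ζ κ =>
    ENNReal.ofReal (√(w₀ ζ) * |ζ.1| * ((√(w₁ κ))⁻¹ * (√(w₁ (ζ - κ)))⁻¹))
  have hk2 : ∀ ζ κ, k ζ κ ^ 2 ≤ ENNReal.ofReal A * (kernel α β M (2 - θ) ζ κ +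
      kernel α β M (2 - θ) κ ζ + kernel α β M (2 - θ) (ζ - κ) ζ) := by
    intro ζ κ
    refine le_trans (le_of_eq ?_) (hk ζ κ)
    simp only [k]
    rw [← ENNReal.ofReal_pow (by positivity)]
    congr 1
    rw [mul_pow, mul_pow, mul_pow, inv_pow, inv_pow, Real.sq_sqrt (hw₀0 _).le,
      Real.sq_sqrt (hw₁0 _).le, Real.sq_sqrt (hw₁0 _).le, sq_abs]
    ring
  have hmain := lintegral_sq_bilinear_le (hF u) (hF v) (measurable_kernel α β M (2 - θ)) hG hk2
  have hbound : ENNReal.ofReal (bourgainNorm α β s (-θ / 2) (u.mul v).dx) ^ 2 ≤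
      D * (ENNReal.ofReal (bourgainNorm α β s ((2 - θ) / 2) u) ^ 2 *
        ENNReal.ofReal (bourgainNorm α β s ((2 - θ) / 2) v) ^ 2) := by
    rw [ofReal_bourgainNorm_sq, ← hF2 u, ← hF2 v]
    refine le_trans (lintegral_mono fun ζ => ?_) hmain
    have hsq : ENNReal.ofReal (weight α β s (-θ / 2) ζ) = ENNReal.ofReal √(w₀ ζ) ^ 2 := by
      rw [← ENNReal.ofReal_pow (Real.sqrt_nonneg _), Real.sq_sqrt (hw₀0 ζ).le]
    rw [hsq, ← mul_pow]
    gcongr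
    calc ENNReal.ofReal √(w₀ ζ) * ‖fourier (u.mul v).dx ζ‖ₑ
        ≤ ENNReal.ofReal √(w₀ ζ) * (ENNReal.ofReal |ζ.1| *
            ∫⁻ κ, ‖fourier u κ‖ₑ * ‖fourier v (ζ - κ)‖ₑ) := by
          gcongr
          exact enorm_fourier_dx_mul_le u v ζ
      _ = ∫⁻ κ, k ζ κ * (F u κ * F v (ζ - κ)) := by
          rw [← mul_assoc, ← ENNReal.ofReal_mul (Real.sqrt_nonneg _),
            ← lintegral_const_mul' _ _ ENNReal.ofReal_ne_top]
          refine lintegral_congr fun κ => ?_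
          simp only [k]
          rw [hinv u, hinv v, ENNReal.ofReal_mul (p := √(w₀ ζ) * |ζ.1|) (by positivity),
            ENNReal.ofReal_mul (p := (√(w₁ κ))⁻¹) (by positivity)]
          ring
  have hu0 : 0 ≤ bourgainNorm α β s ((2 - θ) / 2) u := Real.sqrt_nonneg _
  have hv0 : 0 ≤ bourgainNorm α β s ((2 - θ) / 2) v := Real.sqrt_nonneg _
  have hd0 : 0 ≤ bourgainNorm α β s (-θ / 2) (u.mul v).dx := Real.sqrt_nonneg _
  rw [← ENNReal.ofReal_toReal hDtop, ← ENNReal.ofReal_pow hu0, ← ENNReal.ofReal_pow hv0,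
    ← ENNReal.ofReal_pow hd0, ← ENNReal.ofReal_mul (by positivity),
    ← ENNReal.ofReal_mul ENNReal.toReal_nonneg,
    ENNReal.ofReal_le_ofReal_iff (by positivity)] at hbound
  refine le_of_sq_le_sq ?_ (by positivity)
  refine hbound.trans ?_
  rw [mul_pow, mul_pow, mul_assoc]
  gcongr
  have := Real.sq_sqrt (ENNReal.toReal_nonneg (a := D))
  nlinarith [Real.sqrt_nonneg D.toReal]

/-! ### Extension to the completions -/

/-- A bounded bilinear map on seminormed spaces, with values in a Banach space, extends to the
completions. -/
theorem exists_bilinear_completion_extension {V W X : Type*} [SeminormedAddCommGroup V]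
    [NormedSpace ℂ V] [SeminormedAddCommGroup W] [NormedSpace ℂ W] [NormedAddCommGroup X]
    [NormedSpace ℂ X] [CompleteSpace X] (T : V →ₗ[ℂ] W →ₗ[ℂ] X) {c : ℝ}
    (hT : ∀ v w, ‖T v w‖ ≤ c * ‖v‖ * ‖w‖) :
    ∃ B : UniformSpace.Completion V →L[ℂ] UniformSpace.Completion W →L[ℂ] X,
      (∀ (v : V) (w : W), B v w = T v w) ∧ ∀ v w, ‖B v w‖ ≤ c * ‖v‖ * ‖w‖ := by
  let ιV : V →L[ℂ] UniformSpace.Completion V := UniformSpace.Completion.toComplL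
  let ιW : W →L[ℂ] UniformSpace.Completion W := UniformSpace.Completion.toComplL
  have dV : DenseRange ιV := UniformSpace.Completion.denseRange_coe
  have dW : DenseRange ιW := UniformSpace.Completion.denseRange_coe
  have iV : IsUniformInducing ιV := UniformSpace.Completion.isUniformInducing_coe V
  have iW : IsUniformInducing ιW := UniformSpace.Completion.isUniformInducing_coe W
  let B₁ : UniformSpace.Completion V →L[ℂ] W →L[ℂ] X := (T.mkContinuous₂ c hT).extend ιV
  let B : UniformSpace.Completion V →L[ℂ] UniformSpace.Completion W →L[ℂ] X :=
    (B₁.flip.extend ιW).flip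
  have hB : ∀ (v : V) (w : W), B v w = T v w := by
    intro v w
    have h1 : B₁.flip.extend ιW w = B₁.flip w := ContinuousLinearMap.extend_eq _ dW iW w
    have h2 : B₁ v = T.mkContinuous₂ c hT v := ContinuousLinearMap.extend_eq _ dV iV v
    simp only [B, ContinuousLinearMap.flip_apply, h1, h2, LinearMap.mkContinuous₂_apply]
  refine ⟨B, hB, fun v w => ?_⟩
  refine UniformSpace.Completion.induction_on₂ v w (isClosed_le ?_ ?_) fun v w => ?_
  · fun_prop
  · fun_prop
  · rw [hB, UniformSpace.Completion.norm_coe, UniformSpace.Completion.norm_coe]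
    exact hT v w

theorem Test.add_mul (u v w : Test) : (u + v).mul w = u.mul w + v.mul w := by
  ext z
  exact _root_.add_mul (u z) (v z) (w z)

theorem Test.mul_add (u v w : Test) : u.mul (v + w) = u.mul v + u.mul w := by
  ext z
  exact _root_.mul_add (u z) (v z) (w z)

theorem Test.smul_mul (c : ℂ) (u v : Test) : (c • u).mul v = c • u.mul v := by
  ext z
  exact smul_mul_assoc c (u z) (v z)

theorem Test.mul_smul (c : ℂ) (u v : Test) : u.mul (c • v) = c • u.mul v := by
  ext z
  exact mul_smul_comm c (u z) (v z)

theorem Test.dx_add (u v : Test) : (u + v).dx = u.dx + v.dx := by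
  unfold Test.dx
  exact LineDeriv.lineDerivOp_add _ _ _

theorem Test.dx_smul (c : ℂ) (u : Test) : (c • u).dx = c • u.dx := by
  ext ⟨x, t⟩
  have h : (c • u.dx) (x, t) = c * u.dx (x, t) := rfl
  rw [h, dx_apply, dx_apply]
  exact deriv_const_mul_field c

/-- The bilinear operator `(u, v) ↦ ∂_x (u v)` on normed test functions. -/
noncomputable def dxMul (α β s b b' : ℝ) :
    NormedTest α β s b →ₗ[ℂ] NormedTest α β s b →ₗ[ℂ] BourgainSpace α β s b' :=
  LinearMap.mk₂ ℂ (fun u v => Test.toBourgain α β s b' (Test.mul u v).dx)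
    (fun u v w => by
      rw [show Test.mul (u + v : NormedTest α β s b) w = Test.mul u w + Test.mul v w from
        Test.add_mul u v w, Test.dx_add]
      exact UniformSpace.Completion.coe_add (α := NormedTest α β s b') _ _)
    (fun c u v => by
      rw [show Test.mul (c • u : NormedTest α β s b) v = c • Test.mul u v from
        Test.smul_mul c u v, Test.dx_smul]
      exact UniformSpace.Completion.coe_smul (X := NormedTest α β s b') c _)
    (fun u v w => by
      rw [show Test.mul u (v + w : NormedTest α β s b) = Test.mul u v + Test.mul u w from
        Test.mul_add u v w, Test.dx_add]
      exact UniformSpace.Completion.coe_add (α := NormedTest α β s b') _ _)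
    (fun c u v => by
      rw [show Test.mul u (c • v : NormedTest α β s b) = c • Test.mul u v from
        Test.mul_smul c u v, Test.dx_smul]
      exact UniformSpace.Completion.coe_smul (X := NormedTest α β s b') c _)

end Kawahara

theorem proposition2p2 :
    ∀ s : ℝ, -7 / 4 < s → ∃ b : ℝ, 1 / 2 < b ∧ b < 1 ∧
      ∀ α β : ℝ, β ≠ 0 → ∃ c : ℝ, 0 < c ∧
        ∃ B : Kawahara.BourgainSpace α β s b →L[ℂ] Kawahara.BourgainSpace α β s b →L[ℂ]
            Kawahara.BourgainSpace α β s (b - 1),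
          (∀ u v : Kawahara.Test,
            B (u.toBourgain α β s b) (v.toBourgain α β s b) =
              ((u.mul v).dx).toBourgain α β s (b - 1)) ∧
          ∀ u v : Kawahara.BourgainSpace α β s b, ‖B u v‖ ≤ c * ‖u‖ * ‖v‖ := by
  intro s hs
  obtain ⟨θ, hθ, hθ1, hsθ⟩ : ∃ θ : ℝ, 5 / 6 ≤ θ ∧ θ < 1 ∧ -(2 * s) ≤ 3 / 2 + 2 * θ :=
    -- The value -s - 3/4 solves -2s = 3/2 + 2θ, and it is below 1 exactly when s > -7/4. Only s
    -- enters, so b does not depend on α and β.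
    ⟨max (5 / 6) (-s - 3 / 4), le_max_left _ _, max_lt (by norm_num) (by linarith), by
      have := le_max_right (5 / 6) (-s - 3 / 4)
      linarith⟩
  refine ⟨(2 - θ) / 2, by linarith, by linarith, fun α β hβ => ?_⟩
  obtain ⟨c, hc, hbd⟩ := Kawahara.exists_bourgainNorm_dx_mul_le (α := α) hβ hθ hθ1 hsθ
  have hb : (2 - θ) / 2 - 1 = -θ / 2 := by ring
  rw [hb]
  obtain ⟨B, hB, hBn⟩ := Kawahara.exists_bilinear_completion_extension
    (Kawahara.dxMul α β s ((2 - θ) / 2) (-θ / 2)) (c := c) (fun u v => by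
      have h := hbd u v
      rw [← Kawahara.norm_toBourgain] at h
      exact h)
  exact ⟨c, hc, B, fun u v => hB u v, hBn⟩
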